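/- Let $\mathbb D=\{z\in\mathbb C:|z|<1\}$. For $\sigma\in\partial\mathbb D$, $\angle\lim_{z\to\sigma}$ denotes the angular (non-tangential) limit, i.e. the limit as $z\to\sigma$ inside every Stolz region $\{z\in\mathbb D: |\sigma-z|<M(1-|z|)\}$, $M>1$. A point $\sigma\in\partial\mathbb D$ is a boundary regular fixed point of a holomorphic map $\varphi:\mathbb D\to\mathbb D$ if $\angle\lim_{z\to\sigma}\varphi(z)=\sigma$ and the angular derivative $\varphi'(\sigma):=\angle\lim_{z\to\sigma}\frac{\varphi(z)-\sigma}{z-\sigma}$ exists and is finite. For $F\subset\partial\mathbb D$, let $\mathfrak P[F]$ be the class of all holomorphic maps $\varphi:\mathbb D\to\mathbb D$ for which every $\sigma\in F$ is a boundary regular fixed point. A family $(\varphi_{s,t})_{t\ge s\ge0}$ of holomorphic self-maps of $\mathbb D$ is an evolution family if EF1. $\varphi_{s,s}=\mathrm{id}_{\mathbb D}$ for all $s\ge0$; EF2. $\varphi_{s,t}=\varphi_{u,t}\circ\varphi_{s,u}$ whenever $0\le s\le u\le t$; EF3. for all $z\in\mathbb D$ and $T>0$ there is an integrable function $k_{z,T}:[0,T]\to[0,+\infty)$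 with $|\varphi_{s,u}(z)-\varphi_{s,t}(z)|\le\int_u^t k_{z,T}(\xi)\,d\xi$ whenever $0\le s\le u\le t\le T$. **Proposition.** Let $F:=\{\sigma_1,\dots,\sigma_n\}\subset\partial\mathbb D$, where the $\sigma_j$ are pairwise distinct and $n\ge3$. Let $(\varphi_{s,t})_{t\ge s\ge0}$ be a family in $\mathfrak P[F]$ satisfying EF1 and EF2. Then $\prod_{j=1}^n\varphi_{0,t}'(\sigma_j)\in(0,+\infty)$ for all $t\ge0$, and the following two assertions are equivalent: (i) $(\varphi_{s,t})$ is an evolution family; (ii) the function $[0,+\infty)\ni t\mapsto\prod_{j=1}^n\varphi_{0,t}'(\sigma_j)$ is locally absolutely continuous, i.e. absolutely continuous on $[0,T]$ for every $T>0$. -/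

import Mathlib

open Set Filter Topology MeasureTheory

noncomputable section

namespace DiskEvolution

/-- The open unit disk. -/
def disk : Set ℂ := Metric.ball (0 : ℂ) 1

/-- The Stolz region of aperture `M` at the boundary point `σ`. It is empty for `M ≤ 1`. -/
def stolz (σ : ℂ) (M : ℝ) : Set ℂ := {z : ℂ | z ∈ disk ∧ ‖σ - z‖ < M * (1 - ‖z‖)}

/-- The filter of angular (non-tangential) approach to `σ`: a function tends to a limit along it
if and only if it does so as `z → σ` within every Stolz region at `σ`. -/
def angular (σ : ℂ) : Filter ℂ := ⨆ M : ℝ, 𝓝[stolz σ M] σ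

/-- The angular limit `f(σ)`; meaningful when this limit exists. -/
def angularLim (f : ℂ → ℂ) (σ : ℂ) : ℂ := limUnder (angular σ) f

/-- The angular derivative `f'(σ)`, the angular limit of `(f(z) - f(σ)) / (z - σ)`; meaningful
when the limits exist and are finite. -/
def angularDeriv (f : ℂ → ℂ) (σ : ℂ) : ℂ :=
  limUnder (angular σ) (fun z => (f z - angularLim f σ) / (z - σ))

/-- `f` restricts to a holomorphic self-map of the disk. Values outside the disk are irrelevant. -/
def IsHolSelfMap (f : ℂ → ℂ) : Prop := DifferentiableOn ℂ f disk ∧ MapsTo f disk disk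

/-- `σ` is a boundary regular fixed point of the self-map `f`: it lies on the unit circle, the
angular limit of `f` at `σ` is `σ`, and the angular derivative there exists and is finite. -/
def IsBRFP (f : ℂ → ℂ) (σ : ℂ) : Prop :=
  ‖σ‖ = 1 ∧ Tendsto f (angular σ) (𝓝 σ) ∧
    ∃ d : ℂ, Tendsto (fun z => (f z - σ) / (z - σ)) (angular σ) (𝓝 d)

/-- The class `𝔓[F]` of holomorphic self-maps for which every point of `F` is a boundary regular
fixed point. -/
def classP (F : Set ℂ) : Set (ℂ → ℂ) := {f | IsHolSelfMap f ∧ ∀ σ ∈ F, IsBRFP f σ}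

/-- `φ_{s,s} = id` on the disk for all `s ≥ 0`. -/
def EF1 (φ : ℝ → ℝ → ℂ → ℂ) : Prop := ∀ s, 0 ≤ s → ∀ z ∈ disk, φ s s z = z

/-- `φ_{s,t} = φ_{u,t} ∘ φ_{s,u}` on the disk whenever `0 ≤ s ≤ u ≤ t`. -/
def EF2 (φ : ℝ → ℝ → ℂ → ℂ) : Prop :=
  ∀ s u t, 0 ≤ s → s ≤ u → u ≤ t → ∀ z ∈ disk, φ s t z = φ u t (φ s u z)

/-- For all `z` in the disk and `T > 0` there is a non-negative integrable `k` on `[0,T]` with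
`|φ_{s,u}(z) - φ_{s,t}(z)| ≤ ∫_u^t k` whenever `0 ≤ s ≤ u ≤ t ≤ T`. -/
def EF3 (φ : ℝ → ℝ → ℂ → ℂ) : Prop :=
  ∀ z ∈ disk, ∀ T : ℝ, 0 < T → ∃ k : ℝ → ℝ,
    IntegrableOn k (Icc 0 T) volume ∧ (∀ ξ ∈ Icc 0 T, 0 ≤ k ξ) ∧
      ∀ s u t, 0 ≤ s → s ≤ u → u ≤ t → t ≤ T →
        ‖φ s u z - φ s t z‖ ≤ ∫ ξ in u..t, k ξ

/-- A family `(φ_{s,t})`, `0 ≤ s ≤ t`, of holomorphic self-maps of the disk is an evolution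
family. Only the values of `φ s t` for `0 ≤ s ≤ t` matter. -/
structure IsEvolutionFamily (φ : ℝ → ℝ → ℂ → ℂ) : Prop where
  hol : ∀ s t, 0 ≤ s → s ≤ t → IsHolSelfMap (φ s t)
  ef1 : EF1 φ
  ef2 : EF2 φ
  ef3 : EF3 φ

/-- Local absolute continuity on `[0, ∞)`: absolute continuity on each `[0, T]`. -/
def IsLocallyAC (f : ℝ → ℂ) : Prop := ∀ T : ℝ, 0 < T → AbsolutelyContinuousOnInterval f 0 T

end DiskEvolution

end

open Set Filter Topology MeasureTheory

noncomputable section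

namespace DiskEvolution

open ComplexConjugate

/-! Write `Λ(f)` for the product of the angular derivatives of `f` at the points `σ j`. Julia's
lemma says that `f` expands horodisks at `σ j` by at most the angular derivative there, which is
positive. By the chain rule `Λ` is multiplicative under composition. Playing two horodisks against
each other shows that the derivatives at two distinct points have product at least one
(`HasAngularDeriv.one_le_mul`). With three or more points it follows that `Λ(f) ≥ 1` and that every
single derivative lies between `Λ(f)⁻¹` and `Λ(f)`.

(ii) ⇒ (i): if `Λ(f)` is close to one, three horodisks pin down the image of one base point, and
Harnack's inequality spreads this to `‖f z - z‖ ≤ K (Λ(f) - 1)` on compact sets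
(`exists_norm_sub_le`). Since `Λ(φ_{u,t}) - 1 ≤ Λ(φ_{0,t}) - Λ(φ_{0,u})`, absolute continuity of
`Λ(φ_{0,t})` controls the orbits.

(i) ⇒ (ii): omit short disjoint intervals from the evolution over `[0, T]`
(`exists_remove_intervals`). The resulting map is close to `φ_{0,T}` at finitely many test points
because orbits are absolutely continuous, so by lower semicontinuity of angular derivatives its `Λ`
is hardly smaller than `Λ(φ_{0,T})`. By multiplicativity the omitted intervals then contribute a
factor close to one, which bounds the total increment of `Λ` over them. -/

/-! ### Schwarz–Pick, Lipschitz and Harnack estimates on the disk. -/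

theorem mem_disk {z : ℂ} : z ∈ disk ↔ ‖z‖ < 1 := by simp [disk]

theorem isOpen_disk : IsOpen disk := Metric.isOpen_ball

theorem one_sub_sq_pos {z : ℂ} (hz : z ∈ disk) : 0 < 1 - ‖z‖ ^ 2 := by
  rw [mem_disk] at hz
  nlinarith [norm_nonneg z]

theorem sub_ne_zero_of_mem_disk {σ z : ℂ} (hσ : ‖σ‖ = 1) (hz : z ∈ disk) : σ - z ≠ 0 := by
  rw [mem_disk] at hz
  intro h
  rw [sub_eq_zero] at h
  subst h
  linarith

/-- The involutive automorphism of the disk that interchanges `0` and `a`. -/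
def mobius (a z : ℂ) : ℂ := (a - z) / (1 - conj a * z)

theorem one_sub_conj_mul_ne_zero {a z : ℂ} (ha : a ∈ disk) (hz : z ∈ disk) :
    1 - conj a * z ≠ 0 := by
  rw [mem_disk] at ha hz
  intro h
  have h' : ‖conj a * z‖ = 1 := by rw [← sub_eq_zero.mp h]; simp
  rw [norm_mul, Complex.norm_conj] at h'
  nlinarith [norm_nonneg a, norm_nonneg z]

theorem norm_one_sub_conj_mul_sq (a z : ℂ) :
    ‖1 - conj a * z‖ ^ 2 = ‖a - z‖ ^ 2 + (1 - ‖a‖ ^ 2) * (1 - ‖z‖ ^ 2) := by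
  simp only [Complex.sq_norm, Complex.normSq_apply, Complex.sub_re, Complex.sub_im, Complex.mul_re,
    Complex.mul_im, Complex.conj_re, Complex.conj_im, Complex.one_re, Complex.one_im]
  ring

theorem mobius_mem_disk {a z : ℂ} (ha : a ∈ disk) (hz : z ∈ disk) : mobius a z ∈ disk := by
  have h := one_sub_conj_mul_ne_zero ha hz
  have h1 := norm_one_sub_conj_mul_sq a z
  have h2 := mul_pos (one_sub_sq_pos ha) (one_sub_sq_pos hz)
  rw [mem_disk, mobius, norm_div, div_lt_one (norm_pos_iff.mpr h)]
  exact lt_of_pow_lt_pow_left₀ 2 (norm_nonneg _) (by linarith)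

theorem mobius_mobius {a z : ℂ} (ha : a ∈ disk) (hz : z ∈ disk) : mobius a (mobius a z) = z := by
  have h := one_sub_conj_mul_ne_zero ha hz
  have h' := one_sub_conj_mul_ne_zero ha ha
  have h3 : 1 - conj a * mobius a z = (1 - conj a * a) / (1 - conj a * z) := by
    rw [mobius, eq_div_iff h, sub_mul, mul_assoc, div_mul_cancel₀ _ h]; ring
  have h4 : a - mobius a z = z * (1 - conj a * a) / (1 - conj a * z) := by
    rw [mobius, eq_div_iff h, sub_mul, div_mul_cancel₀ _ h]; ring
  rw [mobius, h3, h4, div_div_div_cancel_right₀ h, mul_div_assoc, div_self, mul_one]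
  exact h'

theorem mobius_zero (a : ℂ) : mobius a 0 = a := by simp [mobius]

theorem mobius_self (a : ℂ) : mobius a a = 0 := by simp [mobius]

theorem isHolSelfMap_mobius {a : ℂ} (ha : a ∈ disk) : IsHolSelfMap (mobius a) := by
  refine ⟨?_, fun z hz => mobius_mem_disk ha hz⟩
  intro z hz
  refine DifferentiableWithinAt.div (by fun_prop) (by fun_prop) (one_sub_conj_mul_ne_zero ha hz)

theorem IsHolSelfMap.comp {f g : ℂ → ℂ} (hf : IsHolSelfMap f) (hg : IsHolSelfMap g) :
    IsHolSelfMap (f ∘ g) :=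
  ⟨hf.1.comp hg.1 hg.2, hf.2.comp hg.2⟩

theorem IsHolSelfMap.norm_mobius_le {f : ℂ → ℂ} (hf : IsHolSelfMap f) {w z : ℂ} (hw : w ∈ disk)
    (hz : z ∈ disk) : ‖mobius (f w) (f z)‖ ≤ ‖mobius w z‖ := by
  have hh := ((isHolSelfMap_mobius (hf.2 hw)).comp hf).comp (isHolSelfMap_mobius hw)
  have := Complex.norm_le_norm_of_mapsTo_ball (R := 1) (z := mobius w z) hh.1
    (hh.2.mono_right Metric.ball_subset_closedBall) (by simp [mobius_zero, mobius_self])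
    (mem_disk.mp (mobius_mem_disk hw hz))
  simpa [mobius_mobius hw hz] using this

/-- The **Schwarz–Pick lemma**. -/
theorem IsHolSelfMap.schwarz_pick {f : ℂ → ℂ} (hf : IsHolSelfMap f) {w z : ℂ} (hw : w ∈ disk)
    (hz : z ∈ disk) :
    ‖1 - conj (f w) * f z‖ ^ 2 * ((1 - ‖w‖ ^ 2) * (1 - ‖z‖ ^ 2)) ≤
      ‖1 - conj w * z‖ ^ 2 * ((1 - ‖f w‖ ^ 2) * (1 - ‖f z‖ ^ 2)) := by
  have h := hf.norm_mobius_le hw hz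
  have e1 := norm_one_sub_conj_mul_sq w z
  have e2 := norm_one_sub_conj_mul_sq (f w) (f z)
  have p1 := norm_pos_iff.mpr (one_sub_conj_mul_ne_zero hw hz)
  have p2 := norm_pos_iff.mpr (one_sub_conj_mul_ne_zero (hf.2 hw) (hf.2 hz))
  rw [mobius, mobius, norm_div, norm_div, div_le_div_iff₀ p2 p1] at h
  have h2 := pow_le_pow_left₀ (by positivity) h 2
  rw [mul_pow, mul_pow] at h2
  have e1' : ‖w - z‖ ^ 2 = ‖1 - conj w * z‖ ^ 2 - (1 - ‖w‖ ^ 2) * (1 - ‖z‖ ^ 2) := by linarith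
  have e2' : ‖f w - f z‖ ^ 2 =
    ‖1 - conj (f w) * f z‖ ^ 2 - (1 - ‖f w‖ ^ 2) * (1 - ‖f z‖ ^ 2) := by linarith
  rw [e1', e2'] at h2
  linarith

/-- Cauchy's estimate on disks of radius `1 - r`, with 2 the diameter of the target. What matters
later is that the constant does not depend on `f`. -/
theorem IsHolSelfMap.norm_sub_le {f : ℂ → ℂ} (hf : IsHolSelfMap f) {r : ℝ} (hr : r < 1) {w z : ℂ}
    (hw : ‖w‖ ≤ r) (hz : ‖z‖ ≤ r) : ‖f z - f w‖ ≤ 2 / (1 - r) * ‖z - w‖ := by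
  have hd : ∀ x ∈ Metric.closedBall (0 : ℂ) r, ‖deriv f x‖ ≤ 2 / (1 - r) := by
    intro x hx
    have hx : ‖x‖ ≤ r := by simpa using hx
    have hsub : Metric.ball x (1 - r) ⊆ disk := by
      intro y hy
      rw [Metric.mem_ball, dist_eq_norm] at hy
      rw [mem_disk]
      have := norm_add_le (y - x) x
      rw [sub_add_cancel] at this
      linarith
    refine Complex.norm_deriv_le_div_of_mapsTo_ball (hf.1.mono hsub) (fun y hy => ?_)
      (by linarith)
    rw [Metric.mem_closedBall, dist_eq_norm]
    have h1 := mem_disk.mp (hf.2 (hsub hy))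
    have h2 := mem_disk.mp (hf.2 (mem_disk.mpr (lt_of_le_of_lt hx hr)))
    linarith [_root_.norm_sub_le (f y) (f x)]
  refine Convex.norm_image_sub_le_of_norm_deriv_le (s := Metric.closedBall (0 : ℂ) r) ?_ hd
    (convex_closedBall _ _) (by simpa using hw) (by simpa using hz)
  intro x hx
  have hx : ‖x‖ ≤ r := by simpa using hx
  exact hf.1.differentiableAt (isOpen_disk.mem_nhds (mem_disk.mpr (by linarith)))

/-- Borel–Carathéodory for `-p`, whose real part lies below every `M > 0`; then `M → 0`. -/
theorem norm_le_of_re_nonneg_zero {p : ℂ → ℂ} (hp : DifferentiableOn ℂ p disk)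
    (hre : ∀ z ∈ disk, 0 ≤ (p z).re) {z : ℂ} (hz : z ∈ disk) :
    ‖p z‖ ≤ (1 + ‖z‖) / (1 - ‖z‖) * ‖p 0‖ := by
  have hz1 := mem_disk.mp hz
  have h : ∀ M : ℝ, 0 < M →
      ‖p z‖ ≤ 2 * M * ‖z‖ / (1 - ‖z‖) + ‖p 0‖ * (1 + ‖z‖) / (1 - ‖z‖) := by
    intro M hM
    have := Complex.borelCaratheodory (f := fun z => -p z) (R := 1) hM hp.neg
      (fun w hw => by
        have := hre w hw
        simp only [mem_ofPred_eq, Complex.neg_re]; linarith) one_pos hz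
    simpa using this
  have hl : Tendsto (fun M : ℝ => 2 * M * ‖z‖ / (1 - ‖z‖) + ‖p 0‖ * (1 + ‖z‖) / (1 - ‖z‖))
      (𝓝[>] 0) (𝓝 (2 * 0 * ‖z‖ / (1 - ‖z‖) + ‖p 0‖ * (1 + ‖z‖) / (1 - ‖z‖))) :=
    (Continuous.tendsto (by fun_prop) 0).mono_left nhdsWithin_le_nhds
  have := ge_of_tendsto hl (eventually_mem_nhdsWithin.mono h)
  calc _ ≤ _ := this
    _ = _ := by ring

/-- A form of **Harnack's inequality** for holomorphic functions with non-negative real part. -/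
theorem norm_le_of_re_nonneg {p : ℂ → ℂ} (hp : DifferentiableOn ℂ p disk)
    (hre : ∀ z ∈ disk, 0 ≤ (p z).re) {z w : ℂ} (hz : z ∈ disk) (hw : w ∈ disk) :
    ‖p z‖ ≤ (1 + ‖z‖) / (1 - ‖z‖) * ((1 + ‖w‖) / (1 - ‖w‖) * ‖p w‖) := by
  have hm := isHolSelfMap_mobius hw
  have h1 := norm_le_of_re_nonneg_zero hp hre hz
  have h2 := norm_le_of_re_nonneg_zero (hp.comp hm.1 hm.2) (fun x hx => hre _ (hm.2 hx)) hw
  have h3 : ‖p 0‖ ≤ (1 + ‖w‖) / (1 - ‖w‖) * ‖p w‖ := by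
    simpa [mobius_self, mobius_zero] using h2
  have := mem_disk.mp hz
  refine h1.trans (mul_le_mul_of_nonneg_left h3 ?_)
  exact div_nonneg (by positivity) (by linarith)

/-! ### Horodisks, Julia's lemma and positivity of the angular derivative. -/

/-- The quantity whose sublevel sets are the horodisks at `σ`. -/
def horo (σ z : ℂ) : ℝ := ‖σ - z‖ ^ 2 / (1 - ‖z‖ ^ 2)

/-- The Cayley map from the disk to the right half-plane that sends `σ` to infinity. -/
def cayley (σ z : ℂ) : ℂ := (σ + z) / (σ - z)

theorem horo_pos {σ z : ℂ} (hσ : ‖σ‖ = 1) (hz : z ∈ disk) : 0 < horo σ z :=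
  div_pos (pow_pos (norm_pos_iff.mpr (sub_ne_zero_of_mem_disk hσ hz)) 2) (one_sub_sq_pos hz)

theorem re_cayley {σ z : ℂ} (hσ : ‖σ‖ = 1) (hz : z ∈ disk) : (cayley σ z).re = (horo σ z)⁻¹ := by
  have h := norm_pos_iff.mpr (sub_ne_zero_of_mem_disk hσ hz)
  have h2 : ‖σ‖ ^ 2 = 1 := by rw [hσ]; norm_num
  rw [cayley, horo, Complex.div_re, inv_div, ← add_div, Complex.normSq_eq_norm_sq]
  congr 1
  rw [← h2]
  simp only [Complex.sq_norm, Complex.normSq_apply, Complex.sub_re, Complex.sub_im,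
    Complex.add_re, Complex.add_im]
  ring

theorem norm_one_sub_conj_mul_of_norm_eq_one {σ : ℂ} (hσ : ‖σ‖ = 1) (u : ℂ) :
    ‖1 - conj σ * u‖ = ‖σ - u‖ := by
  have h : σ * conj σ = 1 := by rw [Complex.mul_conj, Complex.normSq_eq_norm_sq, hσ]; norm_num
  calc ‖1 - conj σ * u‖ = ‖σ‖ * ‖1 - conj σ * u‖ := by rw [hσ, one_mul]
    _ = ‖σ * (1 - conj σ * u)‖ := (norm_mul _ _).symm
    _ = ‖σ - u‖ := by rw [mul_sub, ← mul_assoc, h, mul_one, one_mul]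

theorem norm_radial {σ : ℂ} (hσ : ‖σ‖ = 1) {r : ℝ} (hr : r ∈ Ioo 0 1) : ‖(r : ℂ) * σ‖ = r := by
  rw [norm_mul, hσ, mul_one, Complex.norm_real, Real.norm_of_nonneg hr.1.le]

theorem radial_mem_disk {σ : ℂ} (hσ : ‖σ‖ = 1) {r : ℝ} (hr : r ∈ Ioo 0 1) :
    (r : ℂ) * σ ∈ disk := by
  rw [mem_disk, norm_radial hσ hr]; exact hr.2

theorem eventually_mem_Ioo : ∀ᶠ r : ℝ in 𝓝[<] 1, r ∈ Ioo (0 : ℝ) 1 :=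
  Ioo_mem_nhdsLT one_pos

theorem tendsto_radial_nhds (σ : ℂ) : Tendsto (fun r : ℝ => (r : ℂ) * σ) (𝓝[<] 1) (𝓝 σ) := by
  have : Continuous (fun r : ℝ => (r : ℂ) * σ) := by fun_prop
  simpa using (this.tendsto 1).mono_left nhdsWithin_le_nhds

theorem tendsto_radial {σ : ℂ} (hσ : ‖σ‖ = 1) :
    Tendsto (fun r : ℝ => (r : ℂ) * σ) (𝓝[<] 1) (angular σ) := by
  have h : Tendsto (fun r : ℝ => (r : ℂ) * σ) (𝓝[<] 1) (𝓝[stolz σ 2] σ) := by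
    refine tendsto_nhdsWithin_iff.mpr ⟨tendsto_radial_nhds σ, ?_⟩
    filter_upwards [eventually_mem_Ioo] with r hr
    refine ⟨radial_mem_disk hσ hr, ?_⟩
    have : σ - r * σ = ((1 - r : ℝ) : ℂ) * σ := by push_cast; ring
    rw [this, norm_radial hσ hr, norm_mul, hσ, Complex.norm_real,
      Real.norm_of_nonneg (by linarith [hr.2])]
    linarith [hr.2]
  exact h.mono_right (le_iSup (fun M : ℝ => 𝓝[stolz σ M] σ) 2)

theorem angular_neBot {σ : ℂ} (hσ : ‖σ‖ = 1) : (angular σ).NeBot :=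
  (tendsto_radial hσ).neBot

theorem disk_mem_angular (σ : ℂ) : disk ∈ angular σ :=
  mem_iSup.mpr fun _ => mem_of_superset self_mem_nhdsWithin fun _ h => h.1

/-- **Julia's lemma**. -/
theorem horo_le_of_tendsto {f : ℂ → ℂ} {σ d : ℂ} (hf : IsHolSelfMap f) (hσ : ‖σ‖ = 1)
    (hl : Tendsto f (angular σ) (𝓝 σ))
    (hd : Tendsto (fun z => (f z - σ) / (z - σ)) (angular σ) (𝓝 d)) {z : ℂ} (hz : z ∈ disk) :
    horo σ (f z) ≤ ‖d‖ * horo σ z := by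
  have hr := tendsto_radial hσ
  have h1 : Tendsto (fun r : ℝ => ‖1 - conj (f (r * σ)) * f z‖ ^ 2 / (1 - ‖f z‖ ^ 2)) (𝓝[<] 1)
      (𝓝 (‖1 - conj σ * f z‖ ^ 2 / (1 - ‖f z‖ ^ 2))) := by
    refine Tendsto.div_const (Tendsto.pow (Tendsto.norm (Tendsto.const_sub _
      (Tendsto.mul_const _ ?_))) _) _
    exact (Complex.continuous_conj.tendsto σ).comp (hl.comp hr)
  -- This is Schwarz–Pick at `r * σ` and `z`. The factor `2 / (1 + r)`, which tends to one, comes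
  -- from comparing `1 - ‖f (r * σ)‖ ^ 2 ≤ 2 * ‖f (r * σ) - σ‖` with `1 - r ^ 2 = (1 - r) * (1 +
  -- r)`.
  have h2 : Tendsto (fun r : ℝ => ‖1 - conj ((r : ℂ) * σ) * z‖ ^ 2 / (1 - ‖z‖ ^ 2) *
      (‖(f (r * σ) - σ) / (r * σ - σ)‖ * (2 / (1 + r)))) (𝓝[<] 1)
      (𝓝 (‖1 - conj σ * z‖ ^ 2 / (1 - ‖z‖ ^ 2) * (‖d‖ * (2 / (1 + 1))))) := by
    refine Tendsto.mul (Tendsto.div_const (Tendsto.pow (Tendsto.norm (Tendsto.const_sub _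
      (Tendsto.mul_const _ ?_))) _) _) (Tendsto.mul (hd.comp hr).norm ?_)
    · exact (Complex.continuous_conj.tendsto σ).comp (tendsto_radial_nhds σ)
    · refine Tendsto.mono_left ?_ nhdsWithin_le_nhds
      exact Tendsto.div tendsto_const_nhds (tendsto_id.const_add 1) (by norm_num)
  have h3 := le_of_tendsto_of_tendsto h1 h2 ?_
  · rw [norm_one_sub_conj_mul_of_norm_eq_one hσ, norm_one_sub_conj_mul_of_norm_eq_one hσ] at h3
    unfold horo
    linarith
  filter_upwards [eventually_mem_Ioo] with r hr
  have hw := radial_mem_disk hσ hr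
  have hsp := hf.schwarz_pick hw hz
  have hn := norm_radial hσ hr
  have p1 := one_sub_sq_pos hz
  have p2 := one_sub_sq_pos (hf.2 hz)
  have hden : ‖(r : ℂ) * σ - σ‖ = 1 - r := by
    have : (r : ℂ) * σ - σ = -(((1 - r : ℝ) : ℂ) * σ) := by push_cast; ring
    rw [this, norm_neg, norm_mul, hσ, Complex.norm_real,
      Real.norm_of_nonneg (by linarith [hr.2]), mul_one]
  have p3 : 0 < 1 - r := by linarith [hr.2]
  have p4 : 0 < 1 + r := by linarith [hr.1]
  rw [hn] at hsp
  have hfw : 1 - ‖f (r * σ)‖ ^ 2 ≤ ‖f (r * σ) - σ‖ * 2 := by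
    have e1 := mem_disk.mp (hf.2 hw)
    have e2 := norm_sub_norm_le σ (f (r * σ))
    rw [hσ, norm_sub_rev] at e2
    nlinarith [norm_nonneg (f (r * σ)), norm_nonneg (f (r * σ) - σ)]
  rw [norm_div, hden, div_mul_div_comm, div_mul_div_comm, div_le_div_iff₀ p2 (by positivity)]
  have e3 : (1 - r ^ 2) = (1 - r) * (1 + r) := by ring
  rw [e3] at hsp
  calc ‖1 - conj (f (r * σ)) * f z‖ ^ 2 * ((1 - ‖z‖ ^ 2) * ((1 - r) * (1 + r)))
      = ‖1 - conj (f (r * σ)) * f z‖ ^ 2 * ((1 - r) * (1 + r) * (1 - ‖z‖ ^ 2)) := by ring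
    _ ≤ ‖1 - conj ((r : ℂ) * σ) * z‖ ^ 2 * ((1 - ‖f (r * σ)‖ ^ 2) * (1 - ‖f z‖ ^ 2)) := hsp
    _ ≤ ‖1 - conj ((r : ℂ) * σ) * z‖ ^ 2 * ((‖f (r * σ) - σ‖ * 2) * (1 - ‖f z‖ ^ 2)) := by
        gcongr
    _ = _ := by ring

theorem radial_mul_cayley {f : ℂ → ℂ} {σ : ℂ} (hf : IsHolSelfMap f) (hσ : ‖σ‖ = 1) {r : ℝ}
    (hr : r ∈ Ioo 0 1) : ((1 - r : ℝ) : ℂ) * cayley σ (f (r * σ)) =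
      (σ + f (r * σ)) / (σ * ((f (r * σ) - σ) / (r * σ - σ))) := by
  have h0 : σ ≠ 0 := by rw [← norm_pos_iff, hσ]; exact one_pos
  have h1 := sub_ne_zero_of_mem_disk hσ (hf.2 (radial_mem_disk hσ hr))
  have h2 : f (r * σ) - σ ≠ 0 := by rw [← neg_sub]; exact neg_ne_zero.mpr h1
  have h3 : (1 - r : ℂ) ≠ 0 := by
    have : (1 - r : ℝ) ≠ 0 := by linarith [hr.2]
    exact_mod_cast this
  have h4 : (r : ℂ) * σ - σ = -((1 - r) * σ) := by ring
  rw [h4, cayley]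
  push_cast
  have h5 : f (r * σ) - σ = -(σ - f (r * σ)) := by ring
  rw [h5]
  field_simp

theorem tendsto_radial_mul_cayley {f : ℂ → ℂ} {σ d : ℂ} (hf : IsHolSelfMap f) (hσ : ‖σ‖ = 1)
    (hl : Tendsto f (angular σ) (𝓝 σ)) (hd0 : d ≠ 0)
    (hd : Tendsto (fun z => (f z - σ) / (z - σ)) (angular σ) (𝓝 d)) :
    Tendsto (fun r : ℝ => ((1 - r : ℝ) : ℂ) * cayley σ (f (r * σ))) (𝓝[<] 1) (𝓝 (2 / d)) := by
  have h0 : σ ≠ 0 := by rw [← norm_pos_iff, hσ]; exact one_pos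
  have hr := tendsto_radial hσ
  have h : Tendsto (fun r : ℝ => (σ + f (r * σ)) / (σ * ((f (r * σ) - σ) / (r * σ - σ))))
      (𝓝[<] 1) (𝓝 ((σ + σ) / (σ * d))) :=
    ((hl.comp hr).const_add σ).div ((hd.comp hr).const_mul σ) (mul_ne_zero h0 hd0)
  have e : (σ + σ) / (σ * d) = 2 / d := by field_simp; ring
  rw [e] at h
  refine h.congr' ?_
  filter_upwards [eventually_mem_Ioo] with r hr
  exact (radial_mul_cayley hf hσ hr).symm

theorem horo_radial {σ : ℂ} (hσ : ‖σ‖ = 1) {r : ℝ} (hr : r ∈ Ioo 0 1) :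
    horo σ (r * σ) = (1 - r) / (1 + r) := by
  have h1 : σ - r * σ = ((1 - r : ℝ) : ℂ) * σ := by push_cast; ring
  have h2 : 0 < 1 - r := by linarith [hr.2]
  have h3 : 0 < 1 + r := by linarith [hr.1]
  have h4 : 1 - r ^ 2 = (1 - r) * (1 + r) := by ring
  rw [horo, norm_radial hσ hr, h1, norm_mul, hσ, Complex.norm_real, Real.norm_of_nonneg h2.le, h4]
  field_simp

theorem derivative_ne_zero_of_tendsto {f : ℂ → ℂ} {σ d : ℂ} (hf : IsHolSelfMap f) (hσ : ‖σ‖ = 1)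
    (hl : Tendsto f (angular σ) (𝓝 σ))
    (hd : Tendsto (fun z => (f z - σ) / (z - σ)) (angular σ) (𝓝 d)) : d ≠ 0 := by
  rintro rfl
  have h0 : (0 : ℂ) ∈ disk := by simp [mem_disk]
  have := horo_le_of_tendsto hf hσ hl hd h0
  have h1 := horo_pos hσ (hf.2 h0)
  simp at this
  linarith

/-- Julia's lemma along the radius bounds the real part of `(1 - r) * cayley σ (f (r * σ))` below by
`(1 + r) / ‖d‖`. In the limit `2 / ‖d‖ ≤ (2 / d).re`, which forces `d` to be real and positive. -/
theorem eq_norm_of_tendsto {f : ℂ → ℂ} {σ d : ℂ} (hf : IsHolSelfMap f) (hσ : ‖σ‖ = 1)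
    (hl : Tendsto f (angular σ) (𝓝 σ))
    (hd : Tendsto (fun z => (f z - σ) / (z - σ)) (angular σ) (𝓝 d)) : d = (‖d‖ : ℂ) := by
  have hd0 := derivative_ne_zero_of_tendsto hf hσ hl hd
  have hdn := norm_pos_iff.mpr hd0
  have h1 := (Complex.continuous_re.tendsto _).comp (tendsto_radial_mul_cayley hf hσ hl hd0 hd)
  have h2 : Tendsto (fun r : ℝ => (1 + r) / ‖d‖) (𝓝[<] 1) (𝓝 ((1 + 1) / ‖d‖)) :=
    Tendsto.mono_left (Continuous.tendsto (by fun_prop) 1) nhdsWithin_le_nhds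
  have h3 : (1 + 1) / ‖d‖ ≤ (2 / d).re := by
    refine le_of_tendsto_of_tendsto h2 h1 ?_
    filter_upwards [eventually_mem_Ioo] with r hr
    have hw := radial_mem_disk hσ hr
    have h4 := horo_le_of_tendsto hf hσ hl hd hw
    have h5 : 0 < 1 - r := by linarith [hr.2]
    have h6 : 0 < 1 + r := by linarith [hr.1]
    simp only [Function.comp_apply, Complex.re_ofReal_mul]
    rw [re_cayley hσ (hf.2 hw), ← div_eq_mul_inv, div_le_div_iff₀ hdn (horo_pos hσ (hf.2 hw))]
    rw [horo_radial hσ hr] at h4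
    calc (1 + r) * horo σ (f (r * σ)) ≤ (1 + r) * (‖d‖ * ((1 - r) / (1 + r))) := by gcongr
      _ = (1 - r) * ‖d‖ := by field_simp
  have h4 : (2 / d).re = 2 * d.re / ‖d‖ ^ 2 := by
    rw [Complex.div_re, Complex.normSq_eq_norm_sq]; simp
  rw [h4, div_le_div_iff₀ hdn (by positivity)] at h3
  have h5 : ‖d‖ ≤ d.re := by
    by_contra! h
    nlinarith [mul_pos hdn hdn, mul_pos hdn (sub_pos.mpr h)]
  have h6 : d.re = ‖d‖ := le_antisymm (Complex.re_le_norm d) h5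
  have h7 : d.im = 0 := by
    have := Complex.sq_norm d
    rw [Complex.normSq_apply, ← h6] at this
    nlinarith
  exact Complex.ext (by simp [h6]) (by simp [h7])

/-! ### Calculus of angular derivatives. -/

/-- The self-map `f` has a boundary regular fixed point at `σ` with angular derivative `a`. -/
structure HasAngularDeriv (f : ℂ → ℂ) (σ : ℂ) (a : ℝ) : Prop where
  hol : IsHolSelfMap f
  norm_eq_one : ‖σ‖ = 1
  tendsto : Tendsto f (angular σ) (𝓝 σ)
  tendsto_quotient : Tendsto (fun z => (f z - σ) / (z - σ)) (angular σ) (𝓝 (a : ℂ))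
  pos : 0 < a

theorem IsBRFP.hasAngularDeriv {f : ℂ → ℂ} {σ : ℂ} (hf : IsHolSelfMap f) (h : IsBRFP f σ) :
    ∃ a : ℝ, HasAngularDeriv f σ a := by
  obtain ⟨hσ, hl, d, hd⟩ := h
  refine ⟨‖d‖, hf, hσ, hl, ?_, norm_pos_iff.mpr (derivative_ne_zero_of_tendsto hf hσ hl hd)⟩
  rwa [← eq_norm_of_tendsto hf hσ hl hd]

namespace HasAngularDeriv
variable {f g : ℂ → ℂ} {σ : ℂ} {a b : ℝ}

theorem isBRFP (h : HasAngularDeriv f σ a) : IsBRFP f σ :=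
  ⟨h.norm_eq_one, h.tendsto, _, h.tendsto_quotient⟩

theorem horo_le (h : HasAngularDeriv f σ a) {z : ℂ} (hz : z ∈ disk) :
    horo σ (f z) ≤ a * horo σ z := by
  have := horo_le_of_tendsto h.hol h.norm_eq_one h.tendsto h.tendsto_quotient hz
  rwa [Complex.norm_real, Real.norm_of_nonneg h.pos.le] at this

theorem angularLim_eq (h : HasAngularDeriv f σ a) : angularLim f σ = σ :=
  have := angular_neBot h.norm_eq_one
  h.tendsto.limUnder_eq

theorem angularDeriv_eq (h : HasAngularDeriv f σ a) : angularDeriv f σ = a := by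
  have := angular_neBot h.norm_eq_one
  rw [angularDeriv, h.angularLim_eq]
  exact h.tendsto_quotient.limUnder_eq

theorem congr (h : HasAngularDeriv f σ a) (hfg : ∀ z ∈ disk, g z = f z) :
    HasAngularDeriv g σ a where
  hol := ⟨h.hol.1.congr hfg, fun z hz => by rw [hfg z hz]; exact h.hol.2 hz⟩
  norm_eq_one := h.norm_eq_one
  tendsto := h.tendsto.congr' (by
    filter_upwards [disk_mem_angular σ] with z hz using (hfg z hz).symm)
  tendsto_quotient := h.tendsto_quotient.congr' (by
    filter_upwards [disk_mem_angular σ] with z hz using by rw [hfg z hz])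
  pos := h.pos

/-- A self-map preserves non-tangential approach to a boundary regular fixed point. -/
theorem tendsto_angular (h : HasAngularDeriv f σ a) : Tendsto f (angular σ) (angular σ) := by
  have hσ := h.norm_eq_one
  have ha : (a : ℂ) ≠ 0 := by exact_mod_cast h.pos.ne'
  rw [angular, tendsto_iSup]
  intro M
  have hle : 𝓝[stolz σ M] σ ≤ angular σ := le_iSup (fun M : ℝ => 𝓝[stolz σ M] σ) M
  have hinv := ((h.tendsto_quotient.inv₀ ha).norm).mono_left hle
  have hlt : ‖(a : ℂ)⁻¹‖ < a⁻¹ + 1 := by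
    rw [norm_inv, Complex.norm_real, Real.norm_of_nonneg h.pos.le]; linarith
  -- In the Stolz region `horo σ z ≤ M * ‖σ - z‖`; Julia's lemma costs a factor `a`, and near `σ`
  -- one has `‖σ - z‖ ≤ (a⁻¹ + 1) * ‖σ - f z‖`. The 2 comes from `1 - x ^ 2 ≤ 2 * (1 - x)`, and the
  -- added 1 makes the inequality strict.
  refine Tendsto.mono_right ?_ (le_iSup (fun M : ℝ => 𝓝[stolz σ M] σ) (2 * (a * M * (a⁻¹ + 1)) + 1))
  refine tendsto_nhdsWithin_iff.mpr ⟨h.tendsto.mono_left hle, ?_⟩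
  filter_upwards [hinv.eventually (gt_mem_nhds hlt), self_mem_nhdsWithin] with z hz1 hz2
  obtain ⟨hz, hzM⟩ := hz2
  have hfz := h.hol.2 hz
  refine ⟨hfz, ?_⟩
  have hj := h.horo_le hz
  have n1 := norm_pos_iff.mpr (sub_ne_zero_of_mem_disk hσ hz)
  have n2 := norm_pos_iff.mpr (sub_ne_zero_of_mem_disk hσ hfz)
  have d1 := mem_disk.mp hz
  have d2 := mem_disk.mp hfz
  rw [norm_inv, norm_div, inv_div, norm_sub_rev z, norm_sub_rev (f z), div_lt_iff₀ n2] at hz1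
  have ha' := h.pos
  have hM : 0 < M := by
    by_contra! hM
    nlinarith [mul_nonneg (neg_nonneg.mpr hM) (sub_nonneg.mpr d1.le)]
  have q1 : horo σ z ≤ M * ‖σ - z‖ := by
    rw [horo, div_le_iff₀ (one_sub_sq_pos hz)]
    have : M * (1 - ‖z‖) ≤ M * (1 - ‖z‖ ^ 2) := by
      gcongr; nlinarith [norm_nonneg z]
    nlinarith
  have q2 : ‖σ - f z‖ ^ 2 ≤ (a * M * (a⁻¹ + 1) * ‖σ - f z‖) * (1 - ‖f z‖ ^ 2) := by
    rw [← div_le_iff₀ (one_sub_sq_pos hfz)]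
    calc horo σ (f z) ≤ a * horo σ z := hj
      _ ≤ a * (M * ‖σ - z‖) := by gcongr
      _ ≤ a * (M * ((a⁻¹ + 1) * ‖σ - f z‖)) := by gcongr
      _ = _ := by ring
  have q3 : ‖σ - f z‖ ≤ a * M * (a⁻¹ + 1) * (1 - ‖f z‖ ^ 2) := by
    by_contra! hc
    nlinarith [mul_lt_mul_of_pos_left hc n2]
  have q4 : 1 - ‖f z‖ ^ 2 ≤ 2 * (1 - ‖f z‖) := by nlinarith [norm_nonneg (f z)]
  have q5 : 0 < a * M * (a⁻¹ + 1) := by positivity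
  nlinarith [mul_le_mul_of_nonneg_left q4 q5.le]

/-- The chain rule for angular derivatives. -/
theorem comp (hf : HasAngularDeriv f σ a) (hg : HasAngularDeriv g σ b) :
    HasAngularDeriv (f ∘ g) σ (a * b) where
  hol := hf.hol.comp hg.hol
  norm_eq_one := hf.norm_eq_one
  tendsto := hf.tendsto.comp hg.tendsto_angular
  tendsto_quotient := by
    have h := (hf.tendsto_quotient.comp hg.tendsto_angular).mul hg.tendsto_quotient
    rw [Complex.ofReal_mul]
    refine h.congr' ?_
    filter_upwards [disk_mem_angular σ] with z hz
    have h1 : g z - σ ≠ 0 := by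
      rw [← neg_sub]
      exact neg_ne_zero.mpr (sub_ne_zero_of_mem_disk hf.norm_eq_one (hg.hol.2 hz))
    simp only [Function.comp_apply]
    rw [div_mul_div_cancel₀ h1]
  pos := mul_pos hf.pos hg.pos

/-- Julia's bound is attained in the radial limit; lower semicontinuity of the angular derivative
rests on this. -/
theorem tendsto_horo_div (h : HasAngularDeriv f σ a) :
    Tendsto (fun r : ℝ => horo σ (f (r * σ)) / horo σ (r * σ)) (𝓝[<] 1) (𝓝 a) := by
  have hσ := h.norm_eq_one
  have ha : (a : ℂ) ≠ 0 := by exact_mod_cast h.pos.ne'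
  have h1 := (Complex.continuous_re.tendsto _).comp
    (tendsto_radial_mul_cayley h.hol hσ h.tendsto ha h.tendsto_quotient)
  have e1 : (2 / (a : ℂ)).re = 2 / a := by
    rw [← Complex.ofReal_ofNat, ← Complex.ofReal_div, Complex.ofReal_re]
  rw [e1] at h1
  have h2 : Tendsto (fun r : ℝ => 1 + r) (𝓝[<] 1) (𝓝 (1 + 1)) :=
    Tendsto.mono_left (Continuous.tendsto (by fun_prop) 1) nhdsWithin_le_nhds
  have h3 := h2.div h1 (div_pos two_pos h.pos).ne'
  have e2 : (1 + 1) / (2 / a) = a := by have := h.pos.ne'; field_simp; norm_num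
  rw [e2] at h3
  refine h3.congr' ?_
  filter_upwards [eventually_mem_Ioo] with r hr
  have hw := radial_mem_disk hσ hr
  have p := horo_pos hσ (h.hol.2 hw)
  have h5 : 0 < 1 - r := by linarith [hr.2]
  have h6 : 0 < 1 + r := by linarith [hr.1]
  simp only [Pi.div_apply, Function.comp_apply, Complex.re_ofReal_mul]
  rw [re_cayley hσ (h.hol.2 hw), horo_radial hσ hr]
  field_simp

end HasAngularDeriv

/-! ### Horodisks in half-plane coordinates. -/

theorem norm_cayley_sub {σ z s : ℂ} (hσ : ‖σ‖ = 1) (hz : σ - z ≠ 0) (hs : σ - s ≠ 0) :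
    ‖cayley σ z - cayley σ s‖ * (‖σ - z‖ * ‖σ - s‖) = 2 * ‖z - s‖ := by
  have h : (cayley σ z - cayley σ s) * ((σ - z) * (σ - s)) = 2 * (σ * (z - s)) := by
    rw [cayley, cayley]; field_simp; ring
  rw [← norm_mul, ← norm_mul, h, norm_mul, norm_mul, hσ]
  simp

theorem re_cayley_of_norm_eq_one {σ s : ℂ} (hσ : ‖σ‖ = 1) (hs : ‖s‖ = 1) :
    (cayley σ s).re = 0 := by
  have h2 : ‖σ‖ ^ 2 = ‖s‖ ^ 2 := by rw [hσ, hs]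
  rw [cayley, Complex.div_re, ← add_div]
  simp only [Complex.sq_norm, Complex.normSq_apply] at h2
  simp only [Complex.sub_re, Complex.sub_im, Complex.add_re, Complex.add_im]
  rw [div_eq_zero_iff]
  left
  linarith

theorem cayley_injOn {σ s t : ℂ} (hσ : ‖σ‖ = 1) (hs : s ≠ σ) (ht : t ≠ σ)
    (h : cayley σ s = cayley σ t) : s = t := by
  have := norm_cayley_sub hσ (sub_ne_zero.mpr hs.symm) (sub_ne_zero.mpr ht.symm)
  rw [h, sub_self, norm_zero, zero_mul] at this
  rw [← sub_eq_zero, ← norm_eq_zero]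
  linarith

/-- With `σ` sent to infinity, horodisks at another boundary point `s` become disks tangent to the
imaginary axis at `cayley σ s`. -/
theorem sq_norm_cayley_sub {σ z s : ℂ} (hσ : ‖σ‖ = 1) (hz : z ∈ disk) (hs : s ≠ σ) :
    ‖cayley σ z - cayley σ s‖ ^ 2 = 4 / ‖σ - s‖ ^ 2 * (horo s z * (cayley σ z).re) := by
  have hz' := sub_ne_zero_of_mem_disk hσ hz
  have hs' := sub_ne_zero.mpr hs.symm
  have n1 := norm_ne_zero_iff.mpr hz'
  have n2 := norm_ne_zero_iff.mpr hs'
  have n3 := (one_sub_sq_pos hz).ne'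
  have h := norm_cayley_sub hσ hz' hs'
  rw [← eq_div_iff (mul_ne_zero n1 n2)] at h
  rw [h, re_cayley hσ hz, horo, horo, norm_sub_rev s z]
  field_simp
  ring

theorem exists_cayley_eq {σ : ℂ} (hσ : ‖σ‖ = 1) {Z : ℂ} (hZ : 0 < Z.re) :
    ∃ z ∈ disk, cayley σ z = Z := by
  have h0 : σ ≠ 0 := by rw [← norm_pos_iff, hσ]; exact one_pos
  have h1 : Z + 1 ≠ 0 := by
    intro h
    have := congrArg Complex.re h
    simp at this
    linarith
  refine ⟨σ * ((Z - 1) / (Z + 1)), ?_, ?_⟩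
  · rw [mem_disk, norm_mul, hσ, one_mul, norm_div, div_lt_one (norm_pos_iff.mpr h1)]
    refine lt_of_pow_lt_pow_left₀ 2 (norm_nonneg _) ?_
    simp only [Complex.sq_norm, Complex.normSq_apply, Complex.sub_re, Complex.sub_im,
      Complex.add_re, Complex.add_im, Complex.one_re, Complex.one_im]
    nlinarith
  · have e1 : σ + σ * ((Z - 1) / (Z + 1)) = 2 * σ * Z / (Z + 1) := by field_simp; ring
    have e2 : σ - σ * ((Z - 1) / (Z + 1)) = 2 * σ / (Z + 1) := by field_simp; ring
    rw [cayley, e1, e2, div_div_div_cancel_right₀ h1]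
    field_simp

theorem norm_sub_le_cayley {σ z w : ℂ} (hσ : ‖σ‖ = 1) (hz : z ∈ disk) (hw : w ∈ disk) :
    ‖w - z‖ ≤ 2 * ‖cayley σ w - cayley σ z‖ := by
  have h := norm_cayley_sub hσ (sub_ne_zero_of_mem_disk hσ hw) (sub_ne_zero_of_mem_disk hσ hz)
  have h1 := norm_sub_le σ w
  have h2 := norm_sub_le σ z
  rw [hσ] at h1 h2
  have h3 := mem_disk.mp hz
  have h4 := mem_disk.mp hw
  have h5 : ‖σ - w‖ * ‖σ - z‖ ≤ 2 * 2 := by gcongr <;> linarith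
  nlinarith [mul_le_mul_of_nonneg_left h5 (norm_nonneg (cayley σ w - cayley σ z))]

namespace HasAngularDeriv
variable {f : ℂ → ℂ} {σ s : ℂ} {a b : ℝ}

theorem re_cayley_le (h : HasAngularDeriv f σ a) {z : ℂ} (hz : z ∈ disk) :
    (cayley σ z).re / a ≤ (cayley σ (f z)).re := by
  have hσ := h.norm_eq_one
  have h1 := horo_pos hσ hz
  have h2 := horo_pos hσ (h.hol.2 hz)
  have h3 := h.pos
  rw [re_cayley hσ hz, re_cayley hσ (h.hol.2 hz), inv_eq_one_div, inv_eq_one_div, div_div,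
    div_le_div_iff₀ (by positivity) h2]
  linarith [h.horo_le hz]

theorem sq_norm_cayley_sub_le (h : HasAngularDeriv f σ a) (h' : HasAngularDeriv f s b)
    (hs : s ≠ σ) {z : ℂ} (hz : z ∈ disk) :
    ‖cayley σ (f z) - cayley σ s‖ ^ 2 * (cayley σ z).re ≤
      b * ‖cayley σ z - cayley σ s‖ ^ 2 * (cayley σ (f z)).re := by
  have hσ := h.norm_eq_one
  have hfz := h.hol.2 hz
  have p1 : 0 < (cayley σ z).re := by rw [re_cayley hσ hz]; exact inv_pos.mpr (horo_pos hσ hz)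
  have p2 : 0 < (cayley σ (f z)).re := by
    rw [re_cayley hσ hfz]; exact inv_pos.mpr (horo_pos hσ hfz)
  rw [sq_norm_cayley_sub hσ hfz hs, sq_norm_cayley_sub hσ hz hs]
  calc 4 / ‖σ - s‖ ^ 2 * (horo s (f z) * (cayley σ (f z)).re) * (cayley σ z).re
      ≤ 4 / ‖σ - s‖ ^ 2 * (b * horo s z * (cayley σ (f z)).re) * (cayley σ z).re := by
        gcongr
        exact h'.horo_le hz
    _ = _ := by ring

/-- The product of the angular derivatives at two boundary regular fixed points is at least one. -/
theorem one_le_mul (h : HasAngularDeriv f σ a) (h' : HasAngularDeriv f s b) (hs : s ≠ σ) :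
    1 ≤ a * b := by
  have hσ := h.norm_eq_one
  have hx := re_cayley_of_norm_eq_one hσ h'.norm_eq_one
  -- At this test point Julia's lemma at `σ` puts the real part of the image at or above `1 / a`,
  -- while the tangent disk at `s` keeps it at or below `b`.
  obtain ⟨z, hz, hz'⟩ := exists_cayley_eq hσ (Z := cayley σ s + 1) (by simp [hx])
  have h1 := h.re_cayley_le hz
  have h2 := h.sq_norm_cayley_sub_le h' hs hz
  have h3 := Complex.abs_re_le_norm (cayley σ (f z) - cayley σ s)
  have h4 : (cayley σ z).re = 1 := by rw [hz']; simp [hx]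
  rw [Complex.sub_re, hx, sub_zero] at h3
  rw [h4, div_le_iff₀ h.pos] at h1
  rw [h4, hz', add_sub_cancel_left, norm_one] at h2
  have p := h.pos
  have hX : 0 < (cayley σ (f z)).re := by
    by_contra! hc
    nlinarith
  rw [abs_of_pos hX] at h3
  have h5 : (cayley σ (f z)).re ≤ b := by
    have := pow_le_pow_left₀ hX.le h3 2
    by_contra! hc
    nlinarith
  nlinarith

end HasAngularDeriv

/-! ### Quantitative rigidity from three boundary fixed points. -/

theorem sq_add_sq_le_of_horodisk {X Y a e h P : ℝ} (hh : 0 < h) (he : e ^ 2 = h ^ 2) (hX : 0 ≤ X)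
    (ha : a ≤ P) (H : (X ^ 2 + Y ^ 2) * (2 * h) ≤ a * ((2 * h) ^ 2 + e ^ 2) * X) :
    X ^ 2 + Y ^ 2 ≤ 5 / 2 * P * h * X := by
  rw [he] at H
  have h1 : a * (5 * h ^ 2 * X) ≤ P * (5 * h ^ 2 * X) := by gcongr
  refine le_of_mul_le_mul_right ?_ (mul_pos two_pos hh)
  linarith

/-- For `P = 1` the half-plane and the two disks meet only at `(2 * h, 0)`. Adding the disk
inequalities bounds `X` through `(X - 2 * h) * (X - h / 2)`, with simple roots, but controls only `y
^ 2`; taken separately they bound `e * y` linearly from both sides. -/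
theorem abs_sub_le_of_three_horodisks {X y e h P : ℝ} (hh : 0 < h) (he : e ^ 2 = h ^ 2)
    (hP : 1 ≤ P) (hP' : P ≤ 4 / 3) (hX : 2 * h ≤ X * P)
    (h1 : X ^ 2 + (y - e) ^ 2 ≤ 5 / 2 * P * h * X) (h2 : X ^ 2 + (y + e) ^ 2 ≤ 5 / 2 * P * h * X) :
    |X - 2 * h| + |y| ≤ 13 * h * (P - 1) := by
  have hX0 : 0 < X := by
    by_contra! hc
    nlinarith
  have hX1 : 3 / 2 * h ≤ X := by nlinarith
  have hq : 0 ≤ P - 1 := by linarith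
  have ha : (X - 2 * h) * (X - h / 2) ≤ 5 / 2 * (P - 1) * h * X := by nlinarith [sq_nonneg y]
  have hb : X - 2 * h ≤ 15 / 4 * h * (P - 1) := by
    by_contra! hc
    have h3 : 0 < X - h / 2 := by linarith
    have h4 : 2 / 3 * X ≤ X - h / 2 := by linarith
    have h5 : 0 ≤ 15 / 4 * h * (P - 1) := by positivity
    nlinarith [mul_lt_mul_of_pos_right hc h3, mul_le_mul_of_nonneg_left h4 h5]
  have hX4 : X ≤ 4 * h := by nlinarith
  have hc : -(2 * h * (P - 1)) ≤ X - 2 * h := by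
    have : X * P ≤ X + 4 * h * (P - 1) := by nlinarith
    nlinarith
  have hc' : -(4 * h * (P - 1)) ≤ X - 2 * h := by nlinarith
  have hprod : -((X - 2 * h) * (X - h / 2)) ≤ 8 * h ^ 2 * (P - 1) := by
    have h3 : 0 ≤ X - h / 2 := by linarith
    have h4 : X - h / 2 ≤ 4 * h := by linarith
    have h5 : 0 ≤ 2 * h * (P - 1) := by positivity
    nlinarith [mul_le_mul_of_nonneg_right hc h3, mul_le_mul_of_nonneg_left h4 h5]
  have hprod2 : 5 / 2 * (P - 1) * h * X ≤ 10 * h ^ 2 * (P - 1) := by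
    nlinarith [mul_le_mul_of_nonneg_left hX4 (mul_nonneg hq hh.le)]
  have he1 : |e * y| ≤ 9 * h ^ 2 * (P - 1) := by
    rw [abs_le]; constructor <;> nlinarith [sq_nonneg y]
  have he2 : |e| = h := by
    rw [← abs_of_pos hh]; exact (sq_eq_sq_iff_abs_eq_abs e h).mp he
  rw [abs_mul, he2] at he1
  have hy : |y| ≤ 9 * h * (P - 1) := by
    by_contra! hc
    nlinarith
  have hx : |X - 2 * h| ≤ 4 * h * (P - 1) := by
    rw [abs_le]; constructor <;> nlinarith [mul_nonneg hh.le hq]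
  linarith

theorem abs_inv_sub_one_le {a P : ℝ} (ha : 0 < a) (hP : 1 ≤ P) (h1 : P⁻¹ ≤ a) (h2 : a ≤ P) :
    |a⁻¹ - 1| ≤ P - 1 := by
  have hP0 : 0 < P := by linarith
  have h3 : a⁻¹ ≤ P := by rw [inv_le_comm₀ ha hP0]; exact h1
  have h4 : P⁻¹ ≤ a⁻¹ := by gcongr
  have h5 : 1 - P⁻¹ ≤ P - 1 := by
    have : 2 ≤ P + P⁻¹ := by
      have : P * P⁻¹ = 1 := mul_inv_cancel₀ hP0.ne'
      nlinarith [sq_nonneg (P - 1), inv_pos.mpr hP0]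
    linarith
  rw [abs_le]; constructor <;> linarith

theorem exists_norm_cayley_sub_le {σ₁ σ₂ σ₃ : ℂ} (hσ₁ : ‖σ₁‖ = 1) (hσ₂ : ‖σ₂‖ = 1)
    (hσ₃ : ‖σ₃‖ = 1) (h12 : σ₁ ≠ σ₂) (h13 : σ₁ ≠ σ₃) (h23 : σ₂ ≠ σ₃) :
    ∃ z₀ ∈ disk, ∃ C : ℝ, 0 ≤ C ∧ ∀ (f : ℂ → ℂ) (a₁ a₂ a₃ P : ℝ), HasAngularDeriv f σ₁ a₁ →
      HasAngularDeriv f σ₂ a₂ → HasAngularDeriv f σ₃ a₃ → 1 ≤ P → P ≤ 4 / 3 → a₁ ≤ P → a₂ ≤ P →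
      a₃ ≤ P → ‖cayley σ₁ (f z₀) - cayley σ₁ z₀‖ ≤ C * (P - 1) := by
  have hx₂ := re_cayley_of_norm_eq_one hσ₁ hσ₂
  have hx₃ := re_cayley_of_norm_eq_one hσ₁ hσ₃
  obtain ⟨b, hb⟩ : ∃ b, b = (cayley σ₁ σ₂).im := ⟨_, rfl⟩
  obtain ⟨c, hc⟩ : ∃ c, c = (cayley σ₁ σ₃).im := ⟨_, rfl⟩
  have hbc : b ≠ c := fun h => h23 (cayley_injOn hσ₁ h12.symm h13.symm
    (Complex.ext (hx₂.trans hx₃.symm) (by rw [← hb, ← hc, h])))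
  obtain ⟨e, he⟩ : ∃ e, e = (b - c) / 2 := ⟨_, rfl⟩
  obtain ⟨h, hh⟩ : ∃ h, h = |e| := ⟨_, rfl⟩
  have hh0 : 0 < h := by
    rw [hh, he]
    exact abs_pos.mpr (div_ne_zero (sub_ne_zero.mpr hbc) two_ne_zero)
  have heh : e ^ 2 = h ^ 2 := by rw [hh, sq_abs]
  have e4 : (b + c) / 2 - b = -e := by rw [he]; ring
  have e5 : (b + c) / 2 - c = e := by rw [he]; ring
  -- The base point lies over the midpoint of the two finite boundary points, which are `2 * h`
  -- apart. Its real part exceeds `h`: at `h` itself the two roots would merge and the bound would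
  -- no longer be linear.
  obtain ⟨z₀, hz₀, hZ₀⟩ := exists_cayley_eq hσ₁ (Z := ⟨2 * h, (b + c) / 2⟩) (by simpa using hh0)
  refine ⟨z₀, hz₀, 13 * h, by positivity, ?_⟩
  intro f a₁ a₂ a₃ P h₁ h₂ h₃ hP hP43 ha₁ ha₂ ha₃
  have ha₁0 := h₁.pos
  have d1 := h₁.re_cayley_le hz₀
  have d2 := h₁.sq_norm_cayley_sub_le h₂ h12.symm hz₀
  have d3 := h₁.sq_norm_cayley_sub_le h₃ h13.symm hz₀
  rw [hZ₀] at d1 d2 d3 ⊢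
  generalize cayley σ₁ (f z₀) = W at d1 d2 d3 ⊢
  simp only [Complex.sq_norm, Complex.normSq_apply, Complex.sub_re, Complex.sub_im, hx₂, hx₃,
    ← hb, ← hc, e4, e5, sub_zero] at d1 d2 d3
  rw [div_le_iff₀ ha₁0] at d1
  have hX0 : 0 ≤ W.re := by
    by_contra! hneg
    linarith [mul_neg_of_neg_of_pos hneg ha₁0]
  have hsum := abs_sub_le_of_three_horodisks (X := W.re) (y := W.im - (b + c) / 2) (e := e) hh0
    heh hP hP43 (d1.trans (by gcongr)) ?_ ?_
  · refine (Complex.norm_le_abs_re_add_abs_im _).trans ?_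
    rwa [Complex.sub_re, Complex.sub_im]
  · have e6 : W.im - (b + c) / 2 - e = W.im - b := by rw [he]; ring
    rw [e6]
    exact sq_add_sq_le_of_horodisk hh0 heh hX0 ha₂ (by linarith [d2])
  · have e6 : W.im - (b + c) / 2 + e = W.im - c := by rw [he]; ring
    rw [e6]
    exact sq_add_sq_le_of_horodisk hh0 heh hX0 ha₃ (by linarith [d3])

/-- By Julia's lemma `cayley σ ∘ f - a⁻¹ * cayley σ` has non-negative real part, so Harnack's
inequality carries its smallness from `z₀` to `‖z‖ ≤ r`. -/
theorem HasAngularDeriv.norm_cayley_sub_le {f : ℂ → ℂ} {σ z₀ z : ℂ} {a P C r : ℝ}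
    (h : HasAngularDeriv f σ a) (hP : 1 ≤ P) (ha : P⁻¹ ≤ a) (ha' : a ≤ P) (hz₀ : z₀ ∈ disk)
    (hC : ‖cayley σ (f z₀) - cayley σ z₀‖ ≤ C * (P - 1)) (hr0 : 0 ≤ r) (hr : r < 1)
    (hz : ‖z‖ ≤ r) : ‖cayley σ (f z) - cayley σ z‖ ≤
      ((1 + r) / (1 - r) * ((1 + ‖z₀‖) / (1 - ‖z₀‖) * (C + ‖cayley σ z₀‖)) + 2 / (1 - r)) *
        (P - 1) := by
  have hσ := h.norm_eq_one
  have hq : 0 ≤ P - 1 := by linarith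
  have hr1 : 0 < 1 - r := by linarith
  have hzd : z ∈ disk := mem_disk.mpr (by linarith)
  have hinv := abs_inv_sub_one_le h.pos hP ha ha'
  have hH0 : 0 ≤ (1 + ‖z₀‖) / (1 - ‖z₀‖) :=
    div_nonneg (by positivity) (by linarith [mem_disk.mp hz₀])
  have hpd : DifferentiableOn ℂ (fun z => cayley σ (f z) - (a⁻¹ : ℝ) * cayley σ z) disk := by
    have hcd : DifferentiableOn ℂ (cayley σ) disk := fun w hw =>
      DifferentiableWithinAt.div (by fun_prop) (by fun_prop) (sub_ne_zero_of_mem_disk hσ hw)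
    exact (hcd.comp h.hol.1 h.hol.2).sub (hcd.const_mul _)
  have hpre : ∀ w ∈ disk, 0 ≤ (cayley σ (f w) - (a⁻¹ : ℝ) * cayley σ w).re := by
    intro w hw
    rw [Complex.sub_re, Complex.re_ofReal_mul]
    have := h.re_cayley_le hw
    rw [div_eq_inv_mul] at this
    linarith
  have hp := norm_le_of_re_nonneg hpd hpre hzd hz₀
  have hp0 : ‖cayley σ (f z₀) - (a⁻¹ : ℝ) * cayley σ z₀‖ ≤ (C + ‖cayley σ z₀‖) * (P - 1) := by
    have : cayley σ (f z₀) - (a⁻¹ : ℝ) * cayley σ z₀ =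
        (cayley σ (f z₀) - cayley σ z₀) - ((a⁻¹ - 1 : ℝ) : ℂ) * cayley σ z₀ := by push_cast; ring
    rw [this]
    refine (norm_sub_le _ _).trans ?_
    rw [norm_mul, Complex.norm_real, Real.norm_eq_abs, add_mul, mul_comm ‖cayley σ z₀‖]
    exact add_le_add hC (mul_le_mul_of_nonneg_right hinv (norm_nonneg _))
  have hpz : ‖cayley σ (f z) - (a⁻¹ : ℝ) * cayley σ z‖ ≤ (1 + r) / (1 - r) *
      ((1 + ‖z₀‖) / (1 - ‖z₀‖) * ((C + ‖cayley σ z₀‖) * (P - 1))) := by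
    have hz1 : 0 < 1 - ‖z‖ := by linarith
    refine hp.trans ?_
    gcongr
  have hcz : ‖cayley σ z‖ ≤ 2 / (1 - r) := by
    rw [cayley, norm_div]
    have e1 := norm_add_le σ z
    have e2 := norm_sub_norm_le σ z
    rw [hσ] at e1 e2
    exact div_le_div₀ (by norm_num) (by linarith) hr1 (by linarith)
  have : cayley σ (f z) - cayley σ z =
      (cayley σ (f z) - (a⁻¹ : ℝ) * cayley σ z) + ((a⁻¹ - 1 : ℝ) : ℂ) * cayley σ z := by
    push_cast; ring
  rw [this]
  calc _ ≤ _ + _ := norm_add_le _ _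
    _ ≤ (1 + r) / (1 - r) * ((1 + ‖z₀‖) / (1 - ‖z₀‖) * ((C + ‖cayley σ z₀‖) * (P - 1))) +
        (P - 1) * (2 / (1 - r)) := by
      refine add_le_add hpz ?_
      rw [norm_mul, Complex.norm_real, Real.norm_eq_abs]
      gcongr
    _ = _ := by ring

/-- If the angular derivatives at three boundary regular fixed points are close to one, then the
self-map is close to the identity, with a linear bound that is uniform on compact sets. -/
theorem exists_norm_sub_le {σ₁ σ₂ σ₃ : ℂ} (hσ₁ : ‖σ₁‖ = 1) (hσ₂ : ‖σ₂‖ = 1) (hσ₃ : ‖σ₃‖ = 1)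
    (h12 : σ₁ ≠ σ₂) (h13 : σ₁ ≠ σ₃) (h23 : σ₂ ≠ σ₃) {r : ℝ} (hr : r < 1) :
    ∃ K : ℝ, 0 ≤ K ∧ ∀ (f : ℂ → ℂ) (a₁ a₂ a₃ P : ℝ), HasAngularDeriv f σ₁ a₁ →
      HasAngularDeriv f σ₂ a₂ → HasAngularDeriv f σ₃ a₃ → 1 ≤ P → P⁻¹ ≤ a₁ → a₁ ≤ P → a₂ ≤ P →
      a₃ ≤ P → ∀ z, ‖z‖ ≤ r → ‖f z - z‖ ≤ K * (P - 1) := by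
  rcases lt_or_ge r 0 with hr0 | hr0
  · refine ⟨0, le_rfl, fun f _ _ _ _ _ _ _ _ _ _ _ _ z hz => ?_⟩
    linarith [norm_nonneg z]
  obtain ⟨z₀, hz₀, C, hC0, hC⟩ := exists_norm_cayley_sub_le hσ₁ hσ₂ hσ₃ h12 h13 h23
  obtain ⟨A, hA⟩ : ∃ A, A = (1 + r) / (1 - r) *
    ((1 + ‖z₀‖) / (1 - ‖z₀‖) * (C + ‖cayley σ₁ z₀‖)) + 2 / (1 - r) := ⟨_, rfl⟩
  have hA0 : 0 ≤ A := by
    have h1 : 0 < 1 - r := by linarith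
    have h2 : 0 < 1 - ‖z₀‖ := by linarith [mem_disk.mp hz₀]
    rw [hA]; positivity
  -- The 6 covers `P > 4 / 3`, where the trivial bound 2 is below `6 * (P - 1)`; `2 * A` covers the
  -- remaining case.
  refine ⟨6 + 2 * A, by positivity, ?_⟩
  intro f a₁ a₂ a₃ P h₁ h₂ h₃ hP ha₁ ha₁' ha₂ ha₃ z hz
  have hq := mul_nonneg hA0 (sub_nonneg.mpr hP)
  have hzd : z ∈ disk := mem_disk.mpr (by linarith)
  have hfz := h₁.hol.2 hzd
  rcases lt_or_ge (4 / 3) P with hP43 | hP43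
  · linarith [norm_sub_le (f z) z, mem_disk.mp hfz]
  · have h1 := h₁.norm_cayley_sub_le hP ha₁ ha₁' hz₀ (hC f a₁ a₂ a₃ P h₁ h₂ h₃ hP hP43 ha₁' ha₂ ha₃)
      hr0 hr hz
    rw [← hA] at h1
    linarith [norm_sub_le_cayley hσ₁ hzd hfz]

/-- Two horodisks at distinct points meet in a relatively compact subset of the disk. -/
theorem exists_norm_le_of_horo_le {σ₁ σ₂ : ℂ} (h12 : σ₁ ≠ σ₂) {M : ℝ} (hM : 0 < M) :
    ∃ r < 1, ∀ w ∈ disk, horo σ₁ w ≤ M → horo σ₂ w ≤ M → ‖w‖ ≤ r := by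
  have hd : 0 < ‖σ₁ - σ₂‖ := norm_pos_iff.mpr (sub_ne_zero.mpr h12)
  refine ⟨√(1 - ‖σ₁ - σ₂‖ ^ 2 / (4 * M)), ?_, ?_⟩
  · rw [Real.sqrt_lt' one_pos]
    have : 0 < ‖σ₁ - σ₂‖ ^ 2 / (4 * M) := by positivity
    linarith
  intro w hw h1 h2
  apply Real.le_sqrt_of_sq_le
  rw [horo, div_le_iff₀ (one_sub_sq_pos hw)] at h1 h2
  have h3 : ‖σ₁ - σ₂‖ ≤ ‖σ₁ - w‖ + ‖σ₂ - w‖ := by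
    have := norm_sub_le (σ₁ - w) (σ₂ - w)
    rwa [sub_sub_sub_cancel_right] at this
  have h4 : ‖σ₁ - σ₂‖ ^ 2 ≤ 4 * M * (1 - ‖w‖ ^ 2) := by
    nlinarith [sq_nonneg (‖σ₁ - w‖ - ‖σ₂ - w‖), pow_le_pow_left₀ hd.le h3 2]
  have h5 : ‖σ₁ - σ₂‖ ^ 2 / (4 * M) ≤ 1 - ‖w‖ ^ 2 := by
    rw [div_le_iff₀ (by positivity)]; linarith
  linarith

/-! ### Products of angular derivatives. -/

/-- At most one factor is below one, and pairing it with any other factor repairs the product. -/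
theorem one_le_prod_of_pairwise {ι : Type*} [DecidableEq ι] {a : ι → ℝ} (ha : ∀ i, 0 < a i)
    (hp : ∀ i j, i ≠ j → 1 ≤ a i * a j) {s : Finset ι} (hs : 2 ≤ s.card) : 1 ≤ ∏ i ∈ s, a i := by
  by_cases h : ∀ i ∈ s, 1 ≤ a i
  · exact Finset.one_le_prod h
  push Not at h
  obtain ⟨i, hi, hai⟩ := h
  have hone : ∀ j ∈ s.erase i, 1 ≤ a j := by
    intro j hj
    have := hp i j (Finset.ne_of_mem_erase hj).symm
    nlinarith [ha j, ha i]
  have hcard : 0 < (s.erase i).card := by rw [Finset.card_erase_of_mem hi]; omega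
  obtain ⟨j, hj⟩ := Finset.card_pos.mp hcard
  have h1 : a j ≤ ∏ k ∈ s.erase i, a k := by
    rw [← Finset.mul_prod_erase _ _ hj]
    have : 1 ≤ ∏ k ∈ (s.erase i).erase j, a k :=
      Finset.one_le_prod fun k hk => hone k (Finset.mem_of_mem_erase hk)
    nlinarith [ha j]
  rw [← Finset.mul_prod_erase _ _ hi]
  have := hp i j (Finset.ne_of_mem_erase hj).symm
  nlinarith [ha i]

/-- This is where three points are needed: after removal of one factor, at least two remain. -/
theorem le_prod_of_pairwise {n : ℕ} (hn : 3 ≤ n) {a : Fin n → ℝ} (ha : ∀ i, 0 < a i)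
    (hp : ∀ i j, i ≠ j → 1 ≤ a i * a j) (i : Fin n) : a i ≤ ∏ j, a j := by
  rw [← Finset.mul_prod_erase _ _ (Finset.mem_univ i)]
  have : 1 ≤ ∏ k ∈ Finset.univ.erase i, a k := by
    apply one_le_prod_of_pairwise ha hp
    rw [Finset.card_erase_of_mem (Finset.mem_univ i), Finset.card_univ, Fintype.card_fin]
    omega
  nlinarith [ha i]

theorem inv_prod_le_of_pairwise {n : ℕ} (hn : 3 ≤ n) {a : Fin n → ℝ} (ha : ∀ i, 0 < a i)
    (hp : ∀ i j, i ≠ j → 1 ≤ a i * a j) (i : Fin n) : (∏ j, a j)⁻¹ ≤ a i := by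
  have : Nontrivial (Fin n) := Fin.nontrivial_iff_two_le.mpr (by omega)
  obtain ⟨k, hk⟩ := exists_ne i
  have h1 := le_prod_of_pairwise hn ha hp k
  have h2 := hp i k hk.symm
  rw [inv_le_iff_one_le_mul₀ (Finset.prod_pos fun j _ => ha j)]
  nlinarith [ha i]

/-- The product of the (real parts of the) angular derivatives of `f` at the points `σ j`. -/
def derivProd {n : ℕ} (σ : Fin n → ℂ) (f : ℂ → ℂ) : ℝ := ∏ j, (angularDeriv f (σ j)).re

section ClassP
variable {n : ℕ} {σ : Fin n → ℂ} {f g : ℂ → ℂ}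

theorem hasAngularDeriv_of_mem_classP (hf : f ∈ classP (range σ)) (j : Fin n) :
    HasAngularDeriv f (σ j) (angularDeriv f (σ j)).re := by
  obtain ⟨a, ha⟩ := (hf.2 (σ j) (mem_range_self j)).hasAngularDeriv hf.1
  rwa [ha.angularDeriv_eq, Complex.ofReal_re]

theorem prod_angularDeriv_eq (hf : f ∈ classP (range σ)) :
    ∏ j, angularDeriv f (σ j) = (derivProd σ f : ℂ) := by
  rw [derivProd, Complex.ofReal_prod]
  refine Finset.prod_congr rfl fun j _ => ?_
  rw [(hasAngularDeriv_of_mem_classP hf j).angularDeriv_eq, Complex.ofReal_re]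

theorem derivProd_pos (hf : f ∈ classP (range σ)) : 0 < derivProd σ f :=
  Finset.prod_pos fun j _ => (hasAngularDeriv_of_mem_classP hf j).pos

theorem derivProd_eq (h : ∀ j, ∃ a, HasAngularDeriv f (σ j) a ∧ HasAngularDeriv g (σ j) a) :
    derivProd σ f = derivProd σ g := by
  refine Finset.prod_congr rfl fun j _ => ?_
  obtain ⟨a, h1, h2⟩ := h j
  rw [h1.angularDeriv_eq, h2.angularDeriv_eq]

theorem comp_mem_classP (hf : f ∈ classP (range σ)) (hg : g ∈ classP (range σ)) :
    f ∘ g ∈ classP (range σ) := by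
  refine ⟨hf.1.comp hg.1, ?_⟩
  rintro _ ⟨j, rfl⟩
  exact ((hasAngularDeriv_of_mem_classP hf j).comp (hasAngularDeriv_of_mem_classP hg j)).isBRFP

theorem derivProd_comp (hf : f ∈ classP (range σ)) (hg : g ∈ classP (range σ)) :
    derivProd σ (f ∘ g) = derivProd σ f * derivProd σ g := by
  rw [derivProd, derivProd, derivProd, ← Finset.prod_mul_distrib]
  refine Finset.prod_congr rfl fun j _ => ?_
  rw [((hasAngularDeriv_of_mem_classP hf j).comp
    (hasAngularDeriv_of_mem_classP hg j)).angularDeriv_eq, Complex.ofReal_re]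

theorem derivProd_congr (hf : f ∈ classP (range σ)) (h : ∀ z ∈ disk, g z = f z) :
    derivProd σ g = derivProd σ f :=
  derivProd_eq fun j => ⟨_, (hasAngularDeriv_of_mem_classP hf j).congr h,
    hasAngularDeriv_of_mem_classP hf j⟩

theorem one_le_angularDeriv_mul (hinj : Function.Injective σ) (hf : f ∈ classP (range σ))
    (i j : Fin n) (hij : i ≠ j) : 1 ≤ (angularDeriv f (σ i)).re * (angularDeriv f (σ j)).re :=
  (hasAngularDeriv_of_mem_classP hf i).one_le_mul (hasAngularDeriv_of_mem_classP hf j)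
    fun h => hij (hinj h).symm

theorem one_le_derivProd (hn : 3 ≤ n) (hinj : Function.Injective σ) (hf : f ∈ classP (range σ)) :
    1 ≤ derivProd σ f :=
  one_le_prod_of_pairwise (fun j => (hasAngularDeriv_of_mem_classP hf j).pos)
    (one_le_angularDeriv_mul hinj hf) (by rw [Finset.card_univ, Fintype.card_fin]; omega)

theorem angularDeriv_le_derivProd (hn : 3 ≤ n) (hinj : Function.Injective σ)
    (hf : f ∈ classP (range σ)) (j : Fin n) : (angularDeriv f (σ j)).re ≤ derivProd σ f :=
  le_prod_of_pairwise hn (fun j => (hasAngularDeriv_of_mem_classP hf j).pos)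
    (one_le_angularDeriv_mul hinj hf) j

theorem inv_derivProd_le_angularDeriv (hn : 3 ≤ n) (hinj : Function.Injective σ)
    (hf : f ∈ classP (range σ)) (j : Fin n) : (derivProd σ f)⁻¹ ≤ (angularDeriv f (σ j)).re :=
  inv_prod_le_of_pairwise hn (fun j => (hasAngularDeriv_of_mem_classP hf j).pos)
    (one_le_angularDeriv_mul hinj hf) j

theorem exists_norm_sub_le_derivProd (hn : 3 ≤ n) (hσ : ∀ j, ‖σ j‖ = 1)
    (hinj : Function.Injective σ) {r : ℝ} (hr : r < 1) :
    ∃ K : ℝ, 0 ≤ K ∧ ∀ f ∈ classP (range σ), ∀ z, ‖z‖ ≤ r →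
      ‖f z - z‖ ≤ K * (derivProd σ f - 1) := by
  have h01 : (⟨0, by omega⟩ : Fin n) ≠ ⟨1, by omega⟩ := by simp
  have h02 : (⟨0, by omega⟩ : Fin n) ≠ ⟨2, by omega⟩ := by simp
  have h12 : (⟨1, by omega⟩ : Fin n) ≠ ⟨2, by omega⟩ := by simp
  obtain ⟨K, hK0, hK⟩ := exists_norm_sub_le (hσ _) (hσ _) (hσ _) (hinj.ne h01) (hinj.ne h02)
    (hinj.ne h12) hr
  refine ⟨K, hK0, fun f hf z hz => hK f _ _ _ (derivProd σ f) (hasAngularDeriv_of_mem_classP hf _)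
    (hasAngularDeriv_of_mem_classP hf _) (hasAngularDeriv_of_mem_classP hf _)
    (one_le_derivProd hn hinj hf) (inv_derivProd_le_angularDeriv hn hinj hf _)
    (angularDeriv_le_derivProd hn hinj hf _) (angularDeriv_le_derivProd hn hinj hf _)
    (angularDeriv_le_derivProd hn hinj hf _) z hz⟩

theorem exists_norm_le_of_derivProd_le (hn : 3 ≤ n) (hσ : ∀ j, ‖σ j‖ = 1)
    (hinj : Function.Injective σ) {z : ℂ} (hz : z ∈ disk) (P : ℝ) :
    ∃ r < 1, ∀ f ∈ classP (range σ), derivProd σ f ≤ P → ‖f z‖ ≤ r := by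
  have h01 : (⟨0, by omega⟩ : Fin n) ≠ ⟨1, by omega⟩ := by simp
  have hpos := fun j => horo_pos (hσ j) hz
  obtain ⟨M, hM⟩ : ∃ M, M = ∑ j, horo (σ j) z := ⟨_, rfl⟩
  have hle : ∀ j, horo (σ j) z ≤ M := fun j => by
    rw [hM]; exact Finset.single_le_sum (fun j _ => (hpos j).le) (Finset.mem_univ j)
  have hM0 : 0 < M := (hpos ⟨0, by omega⟩).trans_le (hle _)
  obtain ⟨r, hr, h⟩ := exists_norm_le_of_horo_le (hinj.ne h01) (M := max P 1 * M) (by positivity)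
  refine ⟨r, hr, fun f hf hfP => ?_⟩
  have key : ∀ j, horo (σ j) (f z) ≤ max P 1 * M := fun j =>
    ((hasAngularDeriv_of_mem_classP hf j).horo_le hz).trans (mul_le_mul
      (((angularDeriv_le_derivProd hn hinj hf j).trans hfP).trans (le_max_left _ _)) (hle j)
      (hpos j).le (by positivity))
  exact h _ (hf.1.2 hz) (key _) (key _)

end ClassP

/-! ### From absolute continuity of the product to the evolution property. -/

theorem absolutelyContinuousOnInterval_of_dist_le {X Y : Type*} [PseudoMetricSpace X]
    [PseudoMetricSpace Y] {f : ℝ → X} {g : ℝ → Y} {a b : ℝ}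
    (hf : AbsolutelyContinuousOnInterval f a b)
    (h : ∀ x ∈ uIcc a b, ∀ y ∈ uIcc a b, dist (g x) (g y) ≤ dist (f x) (f y)) :
    AbsolutelyContinuousOnInterval g a b := by
  refine squeeze_zero' (Eventually.of_forall fun E => Finset.sum_nonneg fun _ _ => dist_nonneg) ?_
    hf
  filter_upwards [mem_inf_of_right (mem_principal_self _)] with E hE
  exact Finset.sum_le_sum fun i hi => h _ (hE.1 i hi).1 _ (hE.1 i hi).2

section Family
variable {n : ℕ} {σ : Fin n → ℂ} {φ : ℝ → ℝ → ℂ → ℂ}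

theorem derivProd_evolution (hP : ∀ s t, 0 ≤ s → s ≤ t → φ s t ∈ classP (range σ)) (h2 : EF2 φ)
    {s u t : ℝ} (hs : 0 ≤ s) (hsu : s ≤ u) (hut : u ≤ t) :
    derivProd σ (φ s t) = derivProd σ (φ u t) * derivProd σ (φ s u) := by
  have h := hP u t (hs.trans hsu) hut
  have h' := hP s u hs hsu
  rw [← derivProd_comp h h']
  exact derivProd_congr (comp_mem_classP h h') (h2 s u t hs hsu hut)

theorem derivProd_mono (hn : 3 ≤ n) (hinj : Function.Injective σ)
    (hP : ∀ s t, 0 ≤ s → s ≤ t → φ s t ∈ classP (range σ)) (h2 : EF2 φ)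
    {u t : ℝ} (hu : 0 ≤ u) (hut : u ≤ t) : derivProd σ (φ 0 u) ≤ derivProd σ (φ 0 t) := by
  rw [derivProd_evolution hP h2 le_rfl hu hut]
  have h1 := one_le_derivProd hn hinj (hP u t hu hut)
  have h2 := derivProd_pos (hP 0 u le_rfl hu)
  nlinarith

theorem ef3_of_isLocallyAC (hn : 3 ≤ n) (hσ : ∀ j, ‖σ j‖ = 1) (hinj : Function.Injective σ)
    (hP : ∀ s t, 0 ≤ s → s ≤ t → φ s t ∈ classP (range σ)) (h2 : EF2 φ)
    (hac : IsLocallyAC (fun t => ∏ j, angularDeriv (φ 0 t) (σ j))) : EF3 φ := by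
  intro z hz T hT
  have hΛ : AbsolutelyContinuousOnInterval (fun t => derivProd σ (φ 0 t)) 0 T := by
    refine absolutelyContinuousOnInterval_of_dist_le (hac T hT) fun x hx y hy => ?_
    rw [uIcc_of_le hT.le] at hx hy
    rw [prod_angularDeriv_eq (hP 0 x le_rfl hx.1), prod_angularDeriv_eq (hP 0 y le_rfl hy.1),
      Complex.dist_eq, Real.dist_eq, ← Complex.ofReal_sub, Complex.norm_real, Real.norm_eq_abs]
  -- Every `φ s u` with `u ≤ T` has product at most that of `φ 0 T`, so one radius `r`, and hence
  -- one constant `K`, serves all `s` and `u`.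
  obtain ⟨r, hr, hbd⟩ := exists_norm_le_of_derivProd_le hn hσ hinj hz (derivProd σ (φ 0 T))
  obtain ⟨K, hK0, hK⟩ := exists_norm_sub_le_derivProd hn hσ hinj hr
  have hint := hΛ.intervalIntegrable_deriv
  refine ⟨fun ξ => K * |deriv (fun t => derivProd σ (φ 0 t)) ξ|, ?_, fun ξ _ => by positivity, ?_⟩
  · rw [← intervalIntegrable_iff_integrableOn_Icc_of_le hT.le]
    exact hint.abs.const_mul K
  intro s u t hs hsu hut htT
  have hu : 0 ≤ u := hs.trans hsu
  have hsub : uIcc u t ⊆ uIcc 0 T := by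
    rw [uIcc_of_le hut, uIcc_of_le hT.le]; exact Icc_subset_Icc hu htT
  have hsP := hP 0 s le_rfl hs
  have hsuP := hP s u hs hsu
  have hutP := hP u t hu hut
  have hw : ‖φ s u z‖ ≤ r := by
    apply hbd _ hsuP
    have e1 := derivProd_evolution hP h2 le_rfl hs hsu
    have e2 := derivProd_mono hn hinj hP h2 hu (hut.trans htT)
    have e3 := one_le_derivProd hn hinj hsP
    have e4 := derivProd_pos hsuP
    nlinarith
  have hd := hK _ hutP _ hw
  have hinc : derivProd σ (φ u t) - 1 ≤ derivProd σ (φ 0 t) - derivProd σ (φ 0 u) := by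
    rw [derivProd_evolution hP h2 le_rfl hu hut]
    have e1 := one_le_derivProd hn hinj hutP
    have e2 := one_le_derivProd hn hinj (hP 0 u le_rfl hu)
    nlinarith
  rw [h2 s u t hs hsu hut z hz, norm_sub_rev, intervalIntegral.integral_const_mul]
  refine hd.trans (mul_le_mul_of_nonneg_left ?_ hK0)
  rw [← (hΛ.mono hsub).integral_deriv_eq_sub] at hinc
  exact hinc.trans ((le_abs_self _).trans (intervalIntegral.abs_integral_le_integral_abs hut))

/-! ### From the evolution property to absolute continuity of the product. -/

theorem EF3.absolutelyContinuousOnInterval (h3 : EF3 φ) {z : ℂ} (hz : z ∈ disk) {T : ℝ}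
    (hT : 0 < T) : AbsolutelyContinuousOnInterval (fun t => φ 0 t z) 0 T := by
  obtain ⟨k, hk, -, hle⟩ := h3 z hz T hT
  have hk' : IntervalIntegrable k volume 0 T :=
    (intervalIntegrable_iff_integrableOn_Icc_of_le hT.le).mpr hk
  refine absolutelyContinuousOnInterval_of_dist_le
    (hk'.absolutelyContinuousOnInterval_intervalIntegral (c := 0) (by simp)) ?_
  have key : ∀ x ∈ uIcc 0 T, ∀ y ∈ uIcc 0 T, x ≤ y →
      dist (φ 0 x z) (φ 0 y z) ≤ dist (∫ v in (0 : ℝ)..x, k v) (∫ v in (0 : ℝ)..y, k v) := by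
    intro x hx y hy hxy
    have i1 := hk'.mono_set (uIcc_subset_uIcc_left hx)
    have i2 := hk'.mono_set (uIcc_subset_uIcc_left hy)
    rw [dist_comm (∫ v in (0 : ℝ)..x, k v), Real.dist_eq,
      intervalIntegral.integral_interval_sub_left i2 i1, dist_eq_norm]
    rw [uIcc_of_le hT.le] at hx hy
    exact (hle 0 x y le_rfl hx.1 hxy hy.2).trans (le_abs_self _)
  intro x hx y hy
  rcases le_total x y with h | h
  · exact key x hx y hy h
  · rw [dist_comm (φ 0 x z), dist_comm (∫ v in (0 : ℝ)..x, k v)]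
    exact key y hy x hx h

theorem exists_norm_le_of_absolutelyContinuous {γ : ℝ → ℂ} {T : ℝ}
    (h : AbsolutelyContinuousOnInterval γ 0 T) (hd : ∀ t ∈ uIcc 0 T, γ t ∈ disk) :
    ∃ r < 1, ∀ t ∈ uIcc 0 T, ‖γ t‖ ≤ r := by
  obtain ⟨t₀, ht₀, hmax⟩ := isCompact_uIcc.exists_isMaxOn nonempty_uIcc h.continuousOn.norm
  exact ⟨‖γ t₀‖, mem_disk.mp (hd t₀ ht₀), fun t ht => hmax ht⟩

/-- Composing the maps of an evolution family over the complement of finitely many disjoint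
intervals divides the product of the angular derivatives by the contributions of these intervals,
and moves orbits by no more than the orbits move on these intervals, up to a constant. -/
theorem exists_remove_intervals (hP : ∀ s t, 0 ≤ s → s ≤ t → φ s t ∈ classP (range σ))
    (h2 : EF2 φ) {T : ℝ} {a b : ℕ → ℝ} (S : Finset ℕ) :
    (∀ i ∈ S, a i < b i ∧ b i ≤ T) → (S : Set ℕ).PairwiseDisjoint (fun i => Ioc (a i) (b i)) →
    ∀ s₀, 0 ≤ s₀ → s₀ ≤ T → (∀ i ∈ S, s₀ ≤ a i) →
    ∃ ψ ∈ classP (range σ),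
      derivProd σ ψ * ∏ i ∈ S, derivProd σ (φ (a i) (b i)) = derivProd σ (φ s₀ T) ∧
      ∀ z ∈ disk, ∀ r < 1, (∀ t ∈ Icc 0 T, ‖φ 0 t z‖ ≤ r) →
        ‖ψ (φ 0 s₀ z) - φ 0 T z‖ ≤ ∑ i ∈ S, 2 / (1 - r) * ‖φ 0 (a i) z - φ 0 (b i) z‖ := by
  -- Peel off the leftmost interval: by disjointness the others start no earlier than `b i`, so the
  -- induction hypothesis applies with `s₀ = b i`.
  induction S using Finset.induction_on_min_value a with
  | empty =>
    intro _ _ s₀ h0 hT _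
    refine ⟨φ s₀ T, hP _ _ h0 hT, by simp, fun z hz r _ _ => ?_⟩
    rw [h2 0 s₀ T le_rfl h0 hT z hz]
    simp
  | insert i S hi hmin ih =>
    intro hab hdisj s₀ h0 _ hle
    obtain ⟨hi1, hi2⟩ := hab i (Finset.mem_insert_self i S)
    have hi0 := hle i (Finset.mem_insert_self i S)
    have hai : 0 ≤ a i := h0.trans hi0
    have hnext : ∀ x ∈ S, b i ≤ a x := by
      intro x hx
      by_contra! hc
      have hx1 := (hab x (Finset.mem_insert_of_mem hx)).1
      have hne : i ≠ x := fun h => hi (h ▸ hx)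
      have hd := hdisj (Finset.mem_insert_self i S) (Finset.mem_insert_of_mem hx) hne
      have hm : a x < min (b i) (b x) := lt_min hc hx1
      exact Set.disjoint_left.mp hd
        ⟨(hmin x hx).trans_lt hm, min_le_left _ _⟩ ⟨hm, min_le_right _ _⟩
    obtain ⟨ψ, hψ, hprod, hψd⟩ := ih (fun x hx => hab x (Finset.mem_insert_of_mem hx))
      (hdisj.subset (by simp)) (b i) (hai.trans hi1.le) hi2 hnext
    have hg := hP s₀ (a i) h0 hi0
    refine ⟨ψ ∘ φ s₀ (a i), comp_mem_classP hψ hg, ?_, ?_⟩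
    · rw [Finset.prod_insert hi, derivProd_comp hψ hg,
        derivProd_evolution hP h2 h0 (hi0.trans hi1.le) hi2,
        derivProd_evolution hP h2 h0 hi0 hi1.le, ← hprod]
      ring
    · intro z hz r hr hbd
      rw [Finset.sum_insert hi, Function.comp_apply, ← h2 0 s₀ (a i) le_rfl h0 hi0 z hz]
      -- Skipping the interval feeds `ψ` the orbit at time `a i` instead of `b i`; the uniform
      -- Lipschitz bound keeps errors from compounding.
      have e1 := hψ.1.norm_sub_le hr (hbd (b i) ⟨hai.trans hi1.le, hi2⟩)
        (hbd (a i) ⟨hai, hi1.le.trans hi2⟩)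
      exact (norm_sub_le_norm_sub_add_norm_sub _ _ _).trans (add_le_add e1 (hψd z hz r hr hbd))

theorem sum_sub_one_le_prod_sub_one {ι : Type*} {p : ι → ℝ} (S : Finset ι)
    (hp : ∀ i ∈ S, 1 ≤ p i) : ∑ i ∈ S, (p i - 1) ≤ ∏ i ∈ S, p i - 1 := by
  classical
  induction S using Finset.induction_on with
  | empty => simp
  | insert i S hi ih =>
    have h1 := ih fun x hx => hp x (Finset.mem_insert_of_mem hx)
    have h2 := hp i (Finset.mem_insert_self i S)
    have h3 : 1 ≤ ∏ i ∈ S, p i := Finset.one_le_prod fun x hx => hp x (Finset.mem_insert_of_mem hx)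
    rw [Finset.sum_insert hi, Finset.prod_insert hi]
    nlinarith

theorem pow_mul_derivProd_le {f g : ℂ → ℂ} (hf : f ∈ classP (range σ)) {θ : ℝ} (hθ : 0 ≤ θ)
    (h : ∀ j, θ * (angularDeriv f (σ j)).re ≤ (angularDeriv g (σ j)).re) :
    θ ^ n * derivProd σ f ≤ derivProd σ g := by
  calc θ ^ n * derivProd σ f = ∏ j, θ * (angularDeriv f (σ j)).re := by
        rw [derivProd, Finset.prod_mul_distrib, Finset.prod_const, Finset.card_univ,
          Fintype.card_fin]
    _ ≤ _ := Finset.prod_le_prod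
        (fun j _ => mul_nonneg hθ (hasAngularDeriv_of_mem_classP hf j).pos.le) (fun j _ => h j)

/-- Lower semicontinuity of the angular derivative. -/
theorem HasAngularDeriv.exists_forall_lt {f : ℂ → ℂ} {s : ℂ} {a c : ℝ} (hf : HasAngularDeriv f s a)
    (hc : c < a) : ∃ z ∈ disk, ∃ κ > 0, ∀ g b, HasAngularDeriv g s b → ‖g z - f z‖ < κ → c < b := by
  have hs := hf.norm_eq_one
  -- One radial point already shows a horodisk ratio above `c` for `f`. The ratio depends
  -- continuously on the value at that point, and Julia's lemma bounds it by `b` for `g`.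
  obtain ⟨r, hr1, hr⟩ :=
    ((hf.tendsto_horo_div.eventually (lt_mem_nhds hc)).and eventually_mem_Ioo).exists
  have hz := radial_mem_disk hs hr
  have hpos := horo_pos hs hz
  have hcont : ContinuousAt (fun w => horo s w / horo s (r * s)) (f (r * s)) :=
    ((by fun_prop : ContinuousAt (fun w => ‖s - w‖ ^ 2) _).div
      (by fun_prop) (one_sub_sq_pos (hf.hol.2 hz)).ne').div_const _
  obtain ⟨κ, hκ, h⟩ := Metric.eventually_nhds_iff.mp (hcont.eventually (lt_mem_nhds hr1))
  refine ⟨r * s, hz, κ, hκ, fun g b hg hgκ => ?_⟩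
  have := h (y := g (r * s)) (by rwa [dist_eq_norm])
  exact this.trans_le ((div_le_iff₀ hpos).mpr (hg.horo_le hz))

theorem isLocallyAC_of_ef3 (hn : 3 ≤ n) (hinj : Function.Injective σ)
    (hP : ∀ s t, 0 ≤ s → s ≤ t → φ s t ∈ classP (range σ)) (h1 : EF1 φ) (h2 : EF2 φ)
    (h3 : EF3 φ) : IsLocallyAC (fun t => ∏ j, angularDeriv (φ 0 t) (σ j)) := by
  intro T hT
  have hPT := hP 0 T le_rfl hT.le
  have hΛ := derivProd_pos hPT
  refine Metric.tendsto_nhds.mpr fun ε hε => ?_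
  -- `θ` is the admissible relative loss in each of the `n` derivatives when intervals are removed.
  obtain ⟨θ, hθε, hθ⟩ : ∃ θ : ℝ, derivProd σ (φ 0 T) * ((θ ^ n)⁻¹ - 1) < ε ∧ θ ∈ Ioo (0 : ℝ) 1 := by
    have hc : ContinuousAt (fun θ : ℝ => derivProd σ (φ 0 T) * ((θ ^ n)⁻¹ - 1)) 1 :=
      (((continuousAt_id.pow n).inv₀ (by simp)).sub_const 1).const_mul _
    have h0 : derivProd σ (φ 0 T) * (((1 : ℝ) ^ n)⁻¹ - 1) < ε := by simpa using hε
    exact (((hc.eventually (gt_mem_nhds h0)).filter_mono nhdsWithin_le_nhds).and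
      eventually_mem_Ioo).exists
  have hlsc : ∀ j, ∃ z ∈ disk, ∃ κ > 0, ∀ g b, HasAngularDeriv g (σ j) b → ‖g z - φ 0 T z‖ < κ →
      θ * (angularDeriv (φ 0 T) (σ j)).re < b := fun j => by
    have h := hasAngularDeriv_of_mem_classP hPT j
    exact h.exists_forall_lt (by nlinarith [h.pos, hθ.2])
  choose z hz κ hκ hlow using hlsc
  have hac := fun j => h3.absolutelyContinuousOnInterval (hz j) hT
  have hbd := fun j => exists_norm_le_of_absolutelyContinuous (hac j) fun t ht =>
    (hP 0 t le_rfl (by rw [uIcc_of_le hT.le] at ht; exact ht.1)).1.2 (hz j)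
  choose r hr hbd using hbd
  have hC : ∀ j, 0 < 2 / (1 - r j) := fun j => div_pos two_pos (by linarith [hr j])
  have hev := eventually_all.mpr fun j =>
    (hac j).eventually (gt_mem_nhds (div_pos (hκ j) (hC j)))
  filter_upwards [hev, mem_inf_of_right (mem_principal_self _)] with E hE hEd
  obtain ⟨m, I⟩ := E
  simp only at hE
  obtain ⟨hEd1, hEd2⟩ := hEd
  simp only [uIcc_of_le hT.le] at hEd1
  -- The pairs in `E` are unordered and may be degenerate, so they are sorted and the trivial ones
  -- dropped.
  set a : ℕ → ℝ := fun i => min (I i).1 (I i).2 with ha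
  set b : ℕ → ℝ := fun i => max (I i).1 (I i).2 with hb
  set S := (Finset.range m).filter (fun i => (I i).1 ≠ (I i).2) with hS
  have hSm : ∀ i ∈ S, 0 ≤ a i ∧ a i < b i ∧ b i ≤ T := by
    intro i hi
    obtain ⟨hi1, hi2⟩ := Finset.mem_filter.mp hi
    obtain ⟨h4, h5⟩ := hEd1 i hi1
    exact ⟨le_min h4.1 h5.1, min_lt_max.mpr hi2, max_le h4.2 h5.2⟩
  have hsub : S ⊆ Finset.range m := Finset.filter_subset _ _
  have hsumS : ∀ {X : Type} [PseudoMetricSpace X] (γ : ℝ → X),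
      ∑ i ∈ Finset.range m, dist (γ (I i).1) (γ (I i).2) = ∑ i ∈ S, dist (γ (a i)) (γ (b i)) := by
    intro X _ γ
    rw [hS, Finset.sum_filter]
    refine Finset.sum_congr rfl fun i _ => ?_
    split_ifs with h
    · rcases le_total (I i).1 (I i).2 with h' | h'
      · simp only [ha, hb, min_eq_left h', max_eq_right h']
      · simp only [ha, hb, min_eq_right h', max_eq_left h', dist_comm]
    · rw [not_not.mp h, dist_self]
  obtain ⟨ψ, hψ, hprod, hψd⟩ := exists_remove_intervals hP h2 S (fun i hi => (hSm i hi).2)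
    (hEd2.subset (by exact_mod_cast hsub)) 0 le_rfl hT.le (fun i hi => (hSm i hi).1)
  have hlow' : θ ^ n * derivProd σ (φ 0 T) ≤ derivProd σ ψ := by
    refine pow_mul_derivProd_le hPT hθ.1.le fun j => ?_
    refine (hlow j ψ _ (hasAngularDeriv_of_mem_classP hψ j) ?_).le
    have e1 := hψd (z j) (hz j) (r j) (hr j) (by rw [← uIcc_of_le hT.le]; exact hbd j)
    rw [h1 0 le_rfl _ (hz j), ← Finset.mul_sum] at e1
    have e2 := hE j
    rw [hsumS (fun t => φ 0 t (z j)), lt_div_iff₀ (hC j)] at e2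
    simp only [dist_eq_norm] at e2
    linarith
  have hSP := fun i hi => hP (a i) (b i) (hSm i hi).1 (hSm i hi).2.1.le
  have hprodle : ∏ i ∈ S, derivProd σ (φ (a i) (b i)) ≤ (θ ^ n)⁻¹ := by
    have hθn : 0 < θ ^ n := pow_pos hθ.1 n
    have hp0 : 0 < ∏ i ∈ S, derivProd σ (φ (a i) (b i)) :=
      Finset.prod_pos fun i hi => derivProd_pos (hSP i hi)
    rw [← hprod] at hlow'
    generalize ∏ i ∈ S, derivProd σ (φ (a i) (b i)) = p at hlow' hp0 ⊢
    rw [le_inv_comm₀ hp0 hθn, ← one_div, le_div_iff₀ hp0]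
    refine le_of_mul_le_mul_right ?_ (derivProd_pos hψ)
    linarith
  rw [Real.dist_eq, sub_zero, abs_of_nonneg (Finset.sum_nonneg fun _ _ => dist_nonneg)]
  rw [hsumS (fun t => ∏ j, angularDeriv (φ 0 t) (σ j))]
  calc ∑ i ∈ S, dist (∏ j, angularDeriv (φ 0 (a i)) (σ j)) (∏ j, angularDeriv (φ 0 (b i)) (σ j))
      ≤ ∑ i ∈ S, derivProd σ (φ 0 T) * (derivProd σ (φ (a i) (b i)) - 1) := by
        refine Finset.sum_le_sum fun i hi => ?_
        obtain ⟨i1, i2, i3⟩ := hSm i hi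
        have e1 := one_le_derivProd hn hinj (hSP i hi)
        have e2 := derivProd_mono hn hinj hP h2 i1 (i2.le.trans i3)
        rw [prod_angularDeriv_eq (hP 0 (a i) le_rfl i1),
          prod_angularDeriv_eq (hP 0 (b i) le_rfl (i1.trans i2.le)), dist_comm, Complex.dist_eq,
          ← Complex.ofReal_sub, Complex.norm_real,
          derivProd_evolution hP h2 le_rfl i1 i2.le, Real.norm_of_nonneg]
        · nlinarith
        · nlinarith [derivProd_pos (hP 0 (a i) le_rfl i1)]
    _ ≤ derivProd σ (φ 0 T) * ((θ ^ n)⁻¹ - 1) := by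
        rw [← Finset.mul_sum]
        gcongr
        have := sum_sub_one_le_prod_sub_one S fun i hi => one_le_derivProd hn hinj (hSP i hi)
        linarith
    _ < ε := hθε

end Family

end DiskEvolution

end

theorem proposition2 (n : ℕ) (hn : 3 ≤ n) (σ : Fin n → ℂ) (hσ : ∀ j, ‖σ j‖ = 1)
    (hinj : Function.Injective σ) (φ : ℝ → ℝ → ℂ → ℂ)
    (hP : ∀ s t, 0 ≤ s → s ≤ t → φ s t ∈ DiskEvolution.classP (Set.range σ))
    (h1 : DiskEvolution.EF1 φ) (h2 : DiskEvolution.EF2 φ) :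
    (∀ t, 0 ≤ t → ∃ r : ℝ, 0 < r ∧
        ∏ j, DiskEvolution.angularDeriv (φ 0 t) (σ j) = (r : ℂ)) ∧
      (DiskEvolution.IsEvolutionFamily φ ↔
        DiskEvolution.IsLocallyAC
          (fun t => ∏ j, DiskEvolution.angularDeriv (φ 0 t) (σ j))) := by
  refine ⟨fun t ht => ?_, fun h => ?_, fun h => ?_⟩
  · exact ⟨_, DiskEvolution.derivProd_pos (hP 0 t le_rfl ht),
      DiskEvolution.prod_angularDeriv_eq (hP 0 t le_rfl ht)⟩
  · exact DiskEvolution.isLocallyAC_of_ef3 hn hinj hP h1 h2 h.ef3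
  · exact ⟨fun s t hs hst => (hP s t hs hst).1, h1, h2,
      DiskEvolution.ef3_of_isLocallyAC hn hσ hinj hP h2 h⟩
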